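/- Let $1\le p<n$ be integers. Consider the polynomial ring $R=\mathbb C[\{z_{i,j}^{(k)}\}]$ in variables $z_{i,j}^{(k)}$ with $1\le i\le p$, $1\le j\le n$, $k\in\mathbb N_0$, and let $Z(t)$ be the $p\times n$ matrix with entries $z_{i,j}(t)=\sum_{k\ge0}z_{i,j}^{(k)}t^k$. For a $p$-tuple $I=(\alpha_1,\dots,\alpha_p)$ of integers in $[1,n]$ let $D_I^{(k)}$ be the coefficient of $t^k$ in the determinant of the $p\times p$ matrix whose $m$-th column is the $\alpha_m$-th column of $Z(t)$. Let $\tilde{\mathcal P}\subset R$ be the subalgebra generated by all $D_I^{(k)}$ (the semi-infinite Plücker algebra). Order the variables $z_{i,j}^{(k)}$ first by $k$, then by $i$, then by $j$, and let $<_{\mathrm{ss}}$ be the corresponding degree reverse lexicographic order: $m_1<_{\mathrm{ss}}m_2$ if $\deg m_1<\deg m_2$, or if $\deg m_1=\deg m_2$ and the last variable whose exponents in $m_1$ and $m_2$ differ has the larger exponent in $m_1$. Let $\mathrm{in}_{<_{\mathrm{ss}}}f$ denote the $<_{\mathrm{ss}}$-maximal term of $f$, and let $\mathrm{in}_{<_{\mathrm{ss}}}\tilde{\mathcal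 P}\subset R$ be the subalgebra spanned by the initial terms of all elements of $\tilde{\mathcal P}$. It is $\mathbb N_0$-graded, the component of degree $d$ consisting of its elements that are homogeneous of total degree $pd$ (so that $\mathrm{in}_{<_{\mathrm{ss}}}D_I^{(k)}$, when nonzero, has degree $1$). Let $(\tilde Q,\preceq)$ be the poset of elements $q_{i,j}$ with $i\ge1$, $j\ge p+1$, $0\le j-i\le n-1$, where $q_{i_1,j_1}\preceq q_{i_2,j_2}$ if and only if at least one of the following holds: $i_1\le i_2$ and $j_1\le j_2$; or $i_1+p\le i_2$; or $j_1+n-p\le j_2$. For a finite order ideal $J\subset\tilde Q$ let $v_{\tilde Q,\varnothing}(J)\in\{0,1\}^{\tilde Q}$ be its indicator vector, and put $\mathbf y^{v_{\tilde Q,\varnothing}(J)}=\prod_{q\in J}y_q$. Let $A_{\tilde Q,\varnothing}(\tilde Q,\prec)\subset\mathbb C[\{y_q\}_{q\in\tilde Q}][s]$ be the subalgebra generated by the monomials $s\,\mathbf y^{v_{\tilde Q,\varnothing}(J)}$ over all finite order ideals $J$ (the Hibi ring of the order polytope of $\tilde Q$), $\mathbb N_0$-graded by degree in $s$. For an increasing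 $p$-tuple $I=(\alpha_1<\dots<\alpha_p)$ in $[1,n]$ and $k\in\mathbb N_0$ let $\varphi_{\mathrm{ss}}(I^{(k)})\subset\tilde Q$ consist of all $q_{i,j}$ with $i\le k$ and of all $q_{i,j}$ with $k+1\le i\le k+p$ and $j\le i+\alpha_{p+1-(i-k)}-1$. Then $\mathrm{in}_{<_{\mathrm{ss}}}\tilde{\mathcal P}$ is isomorphic to $A_{\tilde Q,\varnothing}(\tilde Q,\prec)$ as an $\mathbb N_0$-graded $\mathbb C$-algebra. The isomorphism is given (uniquely determined) by $$\mathrm{in}_{<_{\mathrm{ss}}}D_I^{(k)}\ \mapsto\ (-1)^{\binom n2+r(n-1)}\,s\,\mathbf y^{v_{\tilde Q,\varnothing}(\varphi_{\mathrm{ss}}(I^{(k)}))}$$ for all increasing $p$-tuples $I$ in $[1,n]$ and all $k\in\mathbb N_0$, where $k\equiv r\pmod p$ with $r\in[0,p-1]$. -/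

import Mathlib

noncomputable section

namespace SemiInfinite

/-! ### Monomial orders, initial terms and initial subalgebras -/

section Initial

variable {σ : Type*}

/-- The strict degree reverse lexicographic order on monomials (given by their exponents) for
linearly ordered variables: compare total degrees first; for equal total degrees, `a < b` if and
only if the last nonzero entry of `a - b` is positive. -/
def DegRevLexLT [LinearOrder σ] (a b : σ →₀ ℕ) : Prop :=
  a.degree < b.degree ∨
    (a.degree = b.degree ∧ ∃ i, b i < a i ∧ ∀ j, i < j → a j = b j)

open Classical in
/-- The initial term of `f` with respect to a strict order `lt` on monomials: the `lt`-maximal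
term that occurs in `f` (with its coefficient), and `0` if `f = 0`. -/
def initialTerm (lt : (σ →₀ ℕ) → (σ →₀ ℕ) → Prop) (f : MvPolynomial σ ℂ) : MvPolynomial σ ℂ :=
  ∑ m ∈ f.support.filter (fun m => ∀ m' ∈ f.support, m' ≠ m → lt m' m),
    MvPolynomial.monomial m (f.coeff m)

/-- The initial subalgebra of `A`: the subalgebra generated by the initial terms of all elements
of `A`. -/
def initialSubalgebra (lt : (σ →₀ ℕ) → (σ →₀ ℕ) → Prop) (A : Subalgebra ℂ (MvPolynomial σ ℂ)) :
    Subalgebra ℂ (MvPolynomial σ ℂ) :=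
  Algebra.adjoin ℂ {g | ∃ f ∈ A, g = initialTerm lt f}

theorem initialTerm_mem (lt : (σ →₀ ℕ) → (σ →₀ ℕ) → Prop)
    {A : Subalgebra ℂ (MvPolynomial σ ℂ)} {f : MvPolynomial σ ℂ} (hf : f ∈ A) :
    initialTerm lt f ∈ initialSubalgebra lt A :=
  Algebra.subset_adjoin ⟨f, hf, rfl⟩

end Initial

/-! ### Generalized Hibi rings -/

section Hibi

variable {P : Type*} [LE P]

open Classical in
/-- The point `v_{O,C}(J)` of a finite order ideal `J`: its coordinate at `q` is `1` if
`q ∈ J ∩ O` or `q ∈ max J ∩ C`, and `0` otherwise. -/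
def idealPoint (O C : Set P) (J : Finset P) : P →₀ ℕ :=
  Finsupp.onFinset J
    (fun q => if (q ∈ J ∧ q ∈ O) ∨ (Maximal (· ∈ J) q ∧ q ∈ C) then 1 else 0) (by
      intro q hq
      by_contra hJ
      apply hq
      rw [if_neg]
      rintro (⟨h, -⟩ | ⟨h, -⟩)
      · exact hJ h
      · exact hJ h.1)

/-- The monomial `s * y ^ u` of `ℂ[P][s]`. -/
def sMonomial (u : P →₀ ℕ) : Polynomial (MvPolynomial P ℂ) :=
  Polynomial.X * Polynomial.C (MvPolynomial.monomial u 1)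

variable (P) in
/-- The generalized Hibi ring `A_{O,C}(P) ⊆ ℂ[P][s]`, generated by the monomials
`s * y ^ v_{O,C}(J)`, where `J` runs over the finite order ideals of `P`. -/
def hibiRing (O C : Set P) : Subalgebra ℂ (Polynomial (MvPolynomial P ℂ)) :=
  Algebra.adjoin ℂ {g | ∃ J : Finset P, IsLowerSet (J : Set P) ∧ g = sMonomial (idealPoint O C J)}

variable (P) in
/-- The component of degree `d` of the generalized Hibi ring, for the grading by degree in `s`:
the elements of the form `c * s ^ d` with `c ∈ ℂ[P]`. -/
def hibiGrade (O C : Set P) (d : ℕ) : Submodule ℂ (hibiRing P O C) :=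
  (LinearMap.range ((Polynomial.monomial (R := MvPolynomial P ℂ) d).restrictScalars ℂ)).comap
    (hibiRing P O C).val.toLinearMap

end Hibi

/-! ### The semi-infinite Plücker algebra -/

section Pluecker

variable (n p : ℕ)

/-- Indices of the variables `z_{i,j}^{(k)}`, ordered first by `k`, then by `i`, then by `j`. -/
abbrev ZVar : Type := ℕ ×ₗ (Fin p ×ₗ Fin n)

variable {n p} in
/-- The variable `z_{i,j}^{(k)}`. -/
def zvar (k : ℕ) (i : Fin p) (j : Fin n) : MvPolynomial (ZVar n p) ℂ :=
  MvPolynomial.X (toLex (k, toLex (i, j)))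

/-- The `p × n` matrix `Z(t)` with entries `z_{i,j}(t) = ∑ k, z_{i,j}^{(k)} t ^ k`. -/
def zMatrix : Matrix (Fin p) (Fin n) (PowerSeries (MvPolynomial (ZVar n p) ℂ)) :=
  Matrix.of fun i j => PowerSeries.mk fun k => zvar k i j

variable {n p} in
/-- `D_I^{(k)}`: the coefficient of `t ^ k` in the determinant of the matrix formed by the columns
`I 0, …, I (p - 1)` of `Z(t)`. -/
def plueckerD (I : Fin p → Fin n) (k : ℕ) : MvPolynomial (ZVar n p) ℂ :=
  PowerSeries.coeff k ((zMatrix n p).submatrix id I).det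

/-- The semi-infinite Plücker algebra, generated by all `D_I^{(k)}`. -/
def plueckerAlgebra : Subalgebra ℂ (MvPolynomial (ZVar n p) ℂ) :=
  Algebra.adjoin ℂ {g | ∃ (I : Fin p → Fin n) (k : ℕ), g = plueckerD I k}

/-- The initial subalgebra of the semi-infinite Plücker algebra. -/
def initialPluecker : Subalgebra ℂ (MvPolynomial (ZVar n p) ℂ) :=
  initialSubalgebra DegRevLexLT (plueckerAlgebra n p)

/-- The component of degree `d` of the initial subalgebra. The generators `D_I^{(k)}`, which are
homogeneous of total degree `p`, have degree `1`; so degree `d` means total degree `p * d`. -/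
def initialGrade (d : ℕ) : Submodule ℂ (initialPluecker n p) :=
  (MvPolynomial.homogeneousSubmodule (ZVar n p) ℂ (p * d)).comap
    (initialPluecker n p).val.toLinearMap

variable {n p} in
/-- The initial term of `D_I^{(k)}`, as an element of the initial subalgebra. -/
def initialD (I : Fin p → Fin n) (k : ℕ) : initialPluecker n p :=
  ⟨initialTerm DegRevLexLT (plueckerD I k),
    initialTerm_mem _ (Algebra.subset_adjoin ⟨I, k, rfl⟩)⟩

end Pluecker

/-! ### The poset `Q̃` -/

section Poset

variable (n p : ℕ)

/-- The set of the `q_{i,j}` with `i ≥ 1`, `j ≥ p + 1` and `0 ≤ j - i ≤ n - 1`. -/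
@[ext]
structure TildeQ where
  i : ℕ
  j : ℕ
  one_le : 1 ≤ i
  lt_j : p + 1 ≤ j
  le : i ≤ j
  lt : j < i + n

/-- `q_{i₁,j₁} ⪯ q_{i₂,j₂}` if `i₁ ≤ i₂` and `j₁ ≤ j₂`, or `i₁ + p ≤ i₂`, or
`j₁ + (n - p) ≤ j₂`. -/
instance : LE (TildeQ n p) where
  le a b := (a.i ≤ b.i ∧ a.j ≤ b.j) ∨ a.i + p ≤ b.i ∨ a.j + (n - p) ≤ b.j

theorem TildeQ.le_def {n p : ℕ} (a b : TildeQ n p) :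
    a ≤ b ↔ (a.i ≤ b.i ∧ a.j ≤ b.j) ∨ a.i + p ≤ b.i ∨ a.j + (n - p) ≤ b.j := Iff.rfl

/-- For `1 ≤ p < n` the relation is a partial order. -/
theorem TildeQ.isPartialOrder (hp : 1 ≤ p) (hpn : p < n) :
    IsPartialOrder (TildeQ n p) (· ≤ ·) where
  refl a := Or.inl ⟨le_rfl, le_rfl⟩
  trans a b c := by
    obtain ⟨i₁, j₁, h₁, h₂, h₃, h₄⟩ := a
    obtain ⟨i₂, j₂, h₅, h₆, h₇, h₈⟩ := b
    obtain ⟨i₃, j₃, h₉, h₁₀, h₁₁, h₁₂⟩ := c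
    simp only [TildeQ.le_def]
    omega
  antisymm a b := by
    obtain ⟨i₁, j₁, h₁, h₂, h₃, h₄⟩ := a
    obtain ⟨i₂, j₂, h₅, h₆, h₇, h₈⟩ := b
    simp only [TildeQ.le_def, TildeQ.mk.injEq]
    omega

variable {n p}

/-- The set `φ_ss(I^{(k)})`. It contains `q_{i,j}` if `i ≤ k`, or if `k + 1 ≤ i ≤ k + p` and
`j ≤ i + α_{p + 1 - (i - k)} - 1`, where `I = (α_1, …, α_p)`. Entries and values of `I` are
counted from `0` here, so `α_{m + 1} = I m + 1`, and `m + 1 = p + 1 - (i - k)` says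
`i + m = k + p`. -/
def phiSet (I : Fin p → Fin n) (k : ℕ) : Set (TildeQ n p) :=
  {q | q.i ≤ k ∨ ∃ m : Fin p, q.i + m = k + p ∧ q.j ≤ q.i + I m}

theorem phiSet_finite (I : Fin p → Fin n) (k : ℕ) : (phiSet I k).Finite := by
  apply Set.Finite.of_finite_image (f := fun q : TildeQ n p => (q.i, q.j))
  · apply (Set.finite_Iic ((k + p, k + p + n) : ℕ × ℕ)).subset
    rintro _ ⟨q, hq, rfl⟩
    have h := q.lt
    have hi : q.i ≤ k + p := by
      rcases hq with hq | ⟨m, hm, -⟩ <;> omega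
    exact ⟨hi, by change q.j ≤ k + p + n; omega⟩
  · intro a _ b _ hab
    exact TildeQ.ext (congrArg Prod.fst hab) (congrArg Prod.snd hab)

/-- `φ_ss(I^{(k)})` as a finite subset of `Q̃`. -/
def phi (I : Fin p → Fin n) (k : ℕ) : Finset (TildeQ n p) := (phiSet_finite I k).toFinset

end Poset

end SemiInfinite

end

/-! Stack the coefficient matrices of `Z(t)` into one matrix with infinitely many rows, the
variables `z_{i,j}^{(k)}` forming row `pk + i` (counted from `0`). Every term of `D_I^{(k)}` takes
the columns of `I` in distinct rows with a fixed sum of row numbers, and the largest one is the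
antidiagonal term in the rows `k, …, k + p - 1` (`isLeading_plueckerD`).

`Q̃` is the union of `p` chains, one for each residue of `i` modulo `p`. Send a variable to the
product of the `y_q` over an initial segment of the chain of its row, with a factor `s` if the row
number is divisible by `p`. Then the initial monomial of `D_I^{(k)}` goes to `s` times the monomial
of the ideal `φ_ss(I^{(k)})` (`sDegree_initExp`, `yExp_initExp`). All finite order ideals are of
this form (`exists_phi_eq`), which gives surjectivity onto the Hibi ring. Injectivity holds on the
monoid of initial exponents, as the exponent of a variable is the drop of the `y`-exponents between
neighbours in a chain (`recoveredExp_eq`).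

It remains to see that the initial terms of the `D_I^{(k)}` generate the initial subalgebra. Call a
product of generators standard if their ideals form a chain. Such a chain is determined by its
length and the sum of its indicator vectors (`Standard.eq_of_sum_eq`), so distinct standard products
have distinct leading monomials. They span by straightening: antisymmetrizing a product of minors of
`Z(t)` and `Z(λt)` over more than `p` columns gives a multiple of a power of `λ - 1`, and the
resulting linear relations rewrite a nonstandard product through products with weights further apart
(`plueckerD_mul_plueckerD_mem`). Hence every nonzero element has the leading monomial of a standard
product (`initialPluecker_eq_adjoin`).

The signs are adjusted by rescaling rows: the products over `p` consecutive rows can be given any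
nonzero values (`exists_scaling`). -/

noncomputable section

namespace SemiInfinite

/-! ### Degree reverse lexicographic order and leading monomials -/

section Order

variable {σ : Type*} [LinearOrder σ]

theorem DegRevLexLT.irrefl (a : σ →₀ ℕ) : ¬ DegRevLexLT a a := by
  rintro (h | ⟨-, i, h, -⟩) <;> exact lt_irrefl _ h

theorem DegRevLexLT.trans {a b c : σ →₀ ℕ} (h₁ : DegRevLexLT a b) (h₂ : DegRevLexLT b c) :
    DegRevLexLT a c := by
  rcases h₁ with h₁ | ⟨h₁, i, hi, hi'⟩
  · rcases h₂ with h₂ | ⟨h₂, -⟩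
    · exact Or.inl (h₁.trans h₂)
    · exact Or.inl (h₂ ▸ h₁)
  · rcases h₂ with h₂ | ⟨h₂, j, hj, hj'⟩
    · exact Or.inl (h₁ ▸ h₂)
    · refine Or.inr ⟨h₁.trans h₂, ?_⟩
      rcases lt_trichotomy i j with h | h | h
      · exact ⟨j, (hi' j h).symm ▸ hj, fun l hl => (hi' l (h.trans hl)).trans (hj' l hl)⟩
      · subst h
        exact ⟨i, hj.trans hi, fun l hl => (hi' l hl).trans (hj' l hl)⟩
      · exact ⟨i, hj' i h ▸ hi, fun l hl => (hi' l hl).trans (hj' l (h.trans hl))⟩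

theorem DegRevLexLT.asymm {a b : σ →₀ ℕ} (h : DegRevLexLT a b) : ¬ DegRevLexLT b a :=
  fun h' => DegRevLexLT.irrefl a (h.trans h')

theorem DegRevLexLT.ne {a b : σ →₀ ℕ} (h : DegRevLexLT a b) : a ≠ b := by
  rintro rfl
  exact DegRevLexLT.irrefl a h

theorem DegRevLexLT.total {a b : σ →₀ ℕ} (h : a ≠ b) : DegRevLexLT a b ∨ DegRevLexLT b a := by
  rcases lt_trichotomy a.degree b.degree with hd | hd | hd
  · exact Or.inl (Or.inl hd)
  · let s := (a.support ∪ b.support).filter fun i => a i ≠ b i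
    have hs : s.Nonempty := by
      obtain ⟨i, hi⟩ := DFunLike.ne_iff.1 h
      refine ⟨i, Finset.mem_filter.2 ⟨?_, hi⟩⟩
      rw [Finset.mem_union, Finsupp.mem_support_iff, Finsupp.mem_support_iff]
      omega
    have hmax : ∀ j, s.max' hs < j → a j = b j := by
      intro j hj
      by_contra hne
      refine (not_lt.2 (s.le_max' j (Finset.mem_filter.2 ⟨?_, hne⟩))) hj
      rw [Finset.mem_union, Finsupp.mem_support_iff, Finsupp.mem_support_iff]
      omega
    rcases lt_or_gt_of_ne (Finset.mem_filter.1 (s.max'_mem hs)).2 with hlt | hlt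
    · exact Or.inr (Or.inr ⟨hd.symm, _, hlt, fun j hj => (hmax j hj).symm⟩)
    · exact Or.inl (Or.inr ⟨hd, _, hlt, hmax⟩)
  · exact Or.inr (Or.inl hd)

theorem DegRevLexLT.add_right {a b : σ →₀ ℕ} (h : DegRevLexLT a b) (c : σ →₀ ℕ) :
    DegRevLexLT (a + c) (b + c) := by
  rcases h with h | ⟨h, i, hi, hi'⟩
  · left
    simpa using h
  · right
    refine ⟨by simpa using h, i, by simpa using hi, fun j hj => by simpa using hi' j hj⟩

theorem DegRevLexLT.add_left {a b : σ →₀ ℕ} (h : DegRevLexLT a b) (c : σ →₀ ℕ) :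
    DegRevLexLT (c + a) (c + b) := by
  simpa only [add_comm c] using h.add_right c

/-- The monomial `m` is the largest one occurring in `f`. -/
def IsLeading (f : MvPolynomial σ ℂ) (m : σ →₀ ℕ) : Prop :=
  m ∈ f.support ∧ ∀ m' ∈ f.support, m' ≠ m → DegRevLexLT m' m

theorem IsLeading.initialTerm_eq {f : MvPolynomial σ ℂ} {m : σ →₀ ℕ} (h : IsLeading f m) :
    initialTerm DegRevLexLT f = MvPolynomial.monomial m (f.coeff m) := by
  classical
  unfold initialTerm
  have : f.support.filter (fun m => ∀ m' ∈ f.support, m' ≠ m → DegRevLexLT m' m) = {m} := by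
    ext x
    simp only [Finset.mem_filter, Finset.mem_singleton]
    constructor
    · rintro ⟨hx, hx'⟩
      by_contra hne
      exact (h.2 x hx hne).asymm (hx' m h.1 (Ne.symm hne))
    · rintro rfl
      exact h
  convert Finset.sum_singleton _ m using 2
  convert this

theorem isLeading_one : IsLeading (1 : MvPolynomial σ ℂ) 0 := by
  classical
  constructor
  · simp
  · intro m' hm' hne
    rw [MvPolynomial.mem_support_iff, MvPolynomial.coeff_one, if_neg hne.symm] at hm'
    exact absurd rfl hm'

/-- Compatibility of the order with addition makes the pair of leading monomials the only one that
contributes to the top exponent, so nothing cancels there. -/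
theorem IsLeading.mul {f g : MvPolynomial σ ℂ} {m m' : σ →₀ ℕ} (hf : IsLeading f m)
    (hg : IsLeading g m') : IsLeading (f * g) (m + m') := by
  classical
  have key : ∀ x ∈ f.support, ∀ y ∈ g.support, (x, y) ≠ (m, m') →
      DegRevLexLT (x + y) (m + m') := by
    intro x hx y hy hne
    by_cases hxm : x = m
    · subst hxm
      exact (hg.2 y hy (fun h => hne (by rw [h]))).add_left _
    · have h₁ := (hf.2 x hx hxm).add_right y
      by_cases hym : y = m'
      · exact hym ▸ h₁
      · exact h₁.trans ((hg.2 y hy hym).add_left _)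
  constructor
  · rw [MvPolynomial.mem_support_iff, MvPolynomial.coeff_mul, Finset.sum_eq_single (m, m')]
    · exact mul_ne_zero (MvPolynomial.mem_support_iff.1 hf.1) (MvPolynomial.mem_support_iff.1 hg.1)
    · rintro ⟨x, y⟩ hxy hne
      rw [Finset.HasAntidiagonal.mem_antidiagonal] at hxy
      by_contra h0
      exact (key x (MvPolynomial.mem_support_iff.2 (left_ne_zero_of_mul h0)) y
        (MvPolynomial.mem_support_iff.2 (right_ne_zero_of_mul h0)) hne).ne hxy
    · intro h
      simp at h
  · intro e he hne
    obtain ⟨x, hx, y, hy, rfl⟩ := Finset.mem_add.1 (MvPolynomial.support_mul f g he)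
    exact key x hx y hy (fun h => hne (by rw [Prod.mk.injEq] at h; rw [h.1, h.2]))

theorem IsLeading.multiset_prod {ι : Type*} {f : ι → MvPolynomial σ ℂ} {m : ι → σ →₀ ℕ}
    (h : ∀ i, IsLeading (f i) (m i)) (s : Multiset ι) :
    IsLeading (s.map f).prod (s.map m).sum := by
  induction s using Multiset.induction_on with
  | empty => simpa using isLeading_one
  | cons a s ih => simpa using (h a).mul ih

theorem exists_degRevLex_max {ι : Type*} (m : ι → σ →₀ ℕ) (s : Finset ι) (hs : s.Nonempty) :
    ∃ a ∈ s, ∀ b ∈ s, m b ≠ m a → DegRevLexLT (m b) (m a) := by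
  classical
  induction hs using Finset.Nonempty.cons_induction with
  | singleton a => exact ⟨a, by simp, fun b hb h => by simp_all⟩
  | cons a s ha hs ih =>
    obtain ⟨c, hc, hmax⟩ := ih
    by_cases h : DegRevLexLT (m c) (m a)
    · refine ⟨a, by simp, fun b hb hne => ?_⟩
      rcases Finset.mem_cons.1 hb with rfl | hb
      · exact absurd rfl hne
      · by_cases hbc : m b = m c
        · exact hbc ▸ h
        · exact (hmax b hb hbc).trans h
    · refine ⟨c, by simp [hc], fun b hb hne => ?_⟩
      rcases Finset.mem_cons.1 hb with rfl | hb
      · exact (DegRevLexLT.total hne).resolve_right h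
      · exact hmax b hb hne

/-- If the `f i` have pairwise distinct leading monomials, then a nonzero linear combination of
them has one of these as its leading monomial. -/
theorem exists_isLeading_of_mem_span {ι : Type*} {f : ι → MvPolynomial σ ℂ} {m : ι → σ →₀ ℕ}
    (h : ∀ i, IsLeading (f i) (m i)) (hm : Function.Injective m) {g : MvPolynomial σ ℂ}
    (hg : g ∈ Submodule.span ℂ (Set.range f)) (hg0 : g ≠ 0) : ∃ i, IsLeading g (m i) := by
  classical
  obtain ⟨c, rfl⟩ := (Finsupp.mem_span_range_iff_exists_finsupp).1 hg
  have hc : c.support.Nonempty := by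
    rw [Finsupp.support_nonempty_iff]
    rintro rfl
    simp at hg0
  obtain ⟨a, ha, hmax⟩ := exists_degRevLex_max m c.support hc
  have key : ∀ b ∈ c.support, b ≠ a → ∀ e ∈ (f b).support, DegRevLexLT e (m a) := by
    intro b hb hba e he
    have h₁ := hmax b hb (fun h => hba (hm h))
    by_cases heb : e = m b
    · exact heb ▸ h₁
    · exact ((h b).2 e he heb).trans h₁
  refine ⟨a, ?_, ?_⟩
  · rw [MvPolynomial.mem_support_iff, Finsupp.sum, MvPolynomial.coeff_sum,
      Finset.sum_eq_single a]
    · rw [MvPolynomial.coeff_smul]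
      exact mul_ne_zero (Finsupp.mem_support_iff.1 ha) (MvPolynomial.mem_support_iff.1 (h a).1)
    · intro b hb hba
      rw [MvPolynomial.coeff_smul]
      by_contra h0
      exact (key b hb hba _ (MvPolynomial.mem_support_iff.2 (right_ne_zero_of_mul h0))).ne rfl
    · intro h
      exact absurd ha h
  · intro e he hne
    rw [MvPolynomial.mem_support_iff, Finsupp.sum, MvPolynomial.coeff_sum] at he
    obtain ⟨b, hb, hbe⟩ := Finset.exists_ne_zero_of_sum_ne_zero he
    rw [MvPolynomial.coeff_smul] at hbe
    have hbe' := MvPolynomial.mem_support_iff.2 (right_ne_zero_of_mul hbe)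
    by_cases hba : b = a
    · subst hba
      exact (h b).2 e hbe' hne
    · exact key b hb hba e hbe'

end Order

/-! ### Initial terms of the generators -/

/-- The extreme case is `N - 1, N - 2, …`; the corrections stand on the left to avoid truncated
subtraction. -/
theorem sum_add_card_le_of_injOn {ι : Type*} (s : Finset ι) (f : ι → ℕ)
    (N : ℕ) (hf : Set.InjOn f s) (hN : ∀ i ∈ s, f i < N) :
    ∑ i ∈ s, f i + s.card + ∑ i ∈ Finset.range s.card, i ≤ s.card * N := by
  induction N generalizing s with
  | zero =>
    have : s = ∅ := Finset.eq_empty_of_forall_notMem fun i hi => by simpa using hN i hi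
    simp [this]
  | succ N ih =>
    classical
    by_cases h : ∃ i ∈ s, f i = N
    · obtain ⟨i, hi, hiN⟩ := h
      have h1 := ih (s.erase i) (hf.mono (by simp)) (fun j hj => by
        have h2 := hN j (Finset.mem_of_mem_erase hj)
        have h3 : f j ≠ N := fun h3 => Finset.ne_of_mem_erase hj
          (hf (Finset.mem_of_mem_erase hj) hi (h3.trans hiN.symm))
        omega)
      have h2 : (s.erase i).card + 1 = s.card := Finset.card_erase_add_one hi
      rw [← Finset.add_sum_erase s f hi, ← h2, Finset.sum_range_succ, hiN]
      nlinarith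
    · have h1 := ih s hf (fun j hj => by
        have h2 := hN j hj
        have h3 : f j ≠ N := fun h3 => h ⟨j, hj, h3⟩
        omega)
      nlinarith

theorem sum_rev_Ici {p : ℕ} (s : Fin p) (k : ℕ) :
    ∑ m ∈ Finset.Ici s, (k + (m.rev : ℕ)) =
      (Finset.Ici s).card * k + ∑ i ∈ Finset.range (Finset.Ici s).card, i := by
  rw [Finset.sum_add_distrib, Finset.sum_const, smul_eq_mul, Fin.card_Ici]
  congr 1
  refine Finset.sum_bij (fun m _ => (m.rev : ℕ)) ?_ ?_ ?_ ?_
  · intro m hm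
    simp only [Finset.mem_Ici, Fin.le_def] at hm
    simp only [Finset.mem_range, Fin.val_rev]
    omega
  · intro a _ b _ h
    exact Fin.rev_injective (Fin.ext h)
  · intro b hb
    rw [Finset.mem_range] at hb
    refine ⟨⟨p - 1 - b, by omega⟩, ?_, ?_⟩
    · simp only [Finset.mem_Ici, Fin.le_def]
      omega
    · simp only [Fin.val_rev]
      omega
  · intro _ _
    rfl

theorem row_injective {p : ℕ} (τ : Equiv.Perm (Fin p)) (l : Fin p → ℕ) :
    Function.Injective fun m => p * l m + (τ m : ℕ) := by
  intro a b h
  have h1 : (p * l a + (τ a : ℕ)) % p = (p * l b + (τ b : ℕ)) % p := congrArg (· % p) h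
  rw [Nat.mul_add_mod, Nat.mul_add_mod, Nat.mod_eq_of_lt (τ a).2, Nat.mod_eq_of_lt (τ b).2] at h1
  exact τ.injective (Fin.ext h1)

section Rows

variable {n p : ℕ} [NeZero p]

/-- The variable in row `r` and column `c`, where the rows of the coefficient matrices of `Z(t)`
are stacked: row `p * k + i` consists of the `z_{i,j}^{(k)}`. -/
def rowVar (r : ℕ) (c : Fin n) : ZVar n p := toLex (r / p, toLex (Fin.ofNat p r, c))

theorem rowVar_mul_add (l : ℕ) (i : Fin p) (c : Fin n) :
    (rowVar (p * l + i) c : ZVar n p) = toLex (l, toLex (i, c)) := by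
  have hp : 0 < p := NeZero.pos p
  have h1 : (p * l + i) / p = l := by
    rw [Nat.mul_add_div hp, Nat.div_eq_of_lt i.2, add_zero]
  have h2 : Fin.ofNat p (p * l + i) = i := by
    ext
    simp [Nat.mod_eq_of_lt i.2]
  rw [rowVar, h1, h2]

theorem exists_rowVar (v : ZVar n p) : ∃ r c, v = rowVar r c :=
  ⟨_, _, (rowVar_mul_add (ofLex v).1 (ofLex (ofLex v).2).1 (ofLex (ofLex v).2).2).symm⟩

theorem rowVar_injective {r r' : ℕ} {c c' : Fin n}
    (h : (rowVar r c : ZVar n p) = rowVar r' c') : r = r' ∧ c = c' := by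
  have h0 := congrArg ofLex h
  simp only [rowVar, ofLex_toLex, Prod.mk.injEq, toLex_inj, Fin.ext_iff, Fin.val_ofNat] at h0
  refine ⟨?_, Fin.ext h0.2.2⟩
  rw [← Nat.div_add_mod r p, ← Nat.div_add_mod r' p, h0.1, h0.2.1]

theorem rowVar_lt_rowVar {r r' : ℕ} {c c' : Fin n} :
    (rowVar r c : ZVar n p) < rowVar r' c' ↔ r < r' ∨ r = r' ∧ c < c' := by
  have key : ∀ {r r' : ℕ} {c c' : Fin n}, r < r' ∨ r = r' ∧ c < c' →
      (rowVar r c : ZVar n p) < rowVar r' c' := by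
    rintro r r' c c' (h | ⟨rfl, h⟩)
    · rw [rowVar, rowVar, Prod.Lex.toLex_lt_toLex]
      rcases (Nat.div_le_div_right (c := p) h.le).lt_or_eq with h1 | h1
      · exact Or.inl h1
      · refine Or.inr ⟨h1, ?_⟩
        rw [Prod.Lex.toLex_lt_toLex]
        left
        rw [Fin.lt_def, Fin.val_ofNat, Fin.val_ofNat]
        have := Nat.div_add_mod r p
        have := Nat.div_add_mod r' p
        rw [h1] at *
        omega
    · rw [rowVar, rowVar, Prod.Lex.toLex_lt_toLex]
      refine Or.inr ⟨rfl, ?_⟩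
      rw [Prod.Lex.toLex_lt_toLex]
      exact Or.inr ⟨rfl, h⟩
  refine ⟨fun h => ?_, key⟩
  by_contra hn
  rcases lt_trichotomy r r' with h1 | h1 | h1
  · exact hn (Or.inl h1)
  · rcases lt_trichotomy c c' with h2 | h2 | h2
    · exact hn (Or.inr ⟨h1, h2⟩)
    · subst h1 h2
      exact lt_irrefl _ h
    · exact lt_asymm h (key (Or.inr ⟨h1.symm, h2⟩))
  · exact lt_asymm h (key (Or.inl h1))

/-- The monomial formed by the entries in row `P m` and column `I m`. -/
def rowExp (P : Fin p → ℕ) (I : Fin p → Fin n) : ZVar n p →₀ ℕ :=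
  ∑ m, Finsupp.single (rowVar (P m) (I m)) 1

theorem rowExp_apply {P : Fin p → ℕ} {I : Fin p → Fin n} (r : ℕ) (c : Fin n) :
    rowExp P I (rowVar r c) = (Finset.univ.filter fun m => P m = r ∧ I m = c).card := by
  classical
  rw [rowExp, Finsupp.finsetSum_apply, Finset.card_filter]
  refine Finset.sum_congr rfl fun m _ => ?_
  rw [Finsupp.single_apply]
  refine if_congr ⟨fun h => rowVar_injective h, fun h => by rw [h.1, h.2]⟩ rfl rfl

theorem rowExp_ne_zero {P : Fin p → ℕ} {I : Fin p → Fin n} {r : ℕ} {c : Fin n} :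
    rowExp P I (rowVar r c) ≠ 0 ↔ ∃ m, P m = r ∧ I m = c := by
  rw [rowExp_apply, Finset.card_ne_zero]
  simp [Finset.Nonempty]

theorem rowExp_le_one {P : Fin p → ℕ} {I : Fin p → Fin n} (hI : Function.Injective I)
    (v : ZVar n p) : rowExp P I v ≤ 1 := by
  obtain ⟨r, c, rfl⟩ := exists_rowVar v
  rw [rowExp_apply, Finset.card_le_one]
  intro a ha b hb
  exact hI (by simp_all)

theorem rowExp_injective {P P' : Fin p → ℕ} {I : Fin p → Fin n} (hI : Function.Injective I)
    (h : rowExp P I = rowExp P' I) : P = P' := by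
  funext m
  have h1 : rowExp P I (rowVar (P m) (I m)) ≠ 0 := rowExp_ne_zero.2 ⟨m, rfl, rfl⟩
  rw [h, rowExp_ne_zero] at h1
  obtain ⟨m', h2, h3⟩ := h1
  rw [← h2, hI h3]

theorem degree_rowExp (P : Fin p → ℕ) (I : Fin p → Fin n) : (rowExp P I).degree = p := by
  simp [rowExp, map_sum]

/-- The exponent of the initial term of `D_I^{(k)}`: the antidiagonal term of the minor in the rows
`k, …, k + p - 1`. -/
def initExp (I : Fin p → Fin n) (k : ℕ) : ZVar n p →₀ ℕ :=
  rowExp (fun m => k + m.rev) I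

/-- Among the monomials with the same sum of row numbers and distinct rows, the antidiagonal
monomial in consecutive rows is the largest one. -/
theorem not_initExp_lt {P : Fin p → ℕ} {I : Fin p → Fin n} {k : ℕ} (hI : StrictMono I)
    (hP : Function.Injective P) (hsum : ∑ m, P m = ∑ m : Fin p, (k + (m.rev : ℕ))) :
    ¬ DegRevLexLT (initExp I k) (rowExp P I) := by
  classical
  rintro (h | ⟨-, v, hv, hv'⟩)
  · rw [initExp, degree_rowExp, degree_rowExp] at h
    exact lt_irrefl _ h
  -- At the last variable where the two monomials differ, the antidiagonal one has exponent `1` and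
  -- the other `0`; below, `s` is the position of this variable.
  obtain ⟨r, c, rfl⟩ := exists_rowVar v
  have h1 : initExp I k (rowVar r c) ≠ 0 := by omega
  have h0 : rowExp P I (rowVar r c) = 0 := by
    have := rowExp_le_one (P := fun m => k + m.rev) hI.injective (rowVar r c)
    rw [initExp] at hv
    omega
  obtain ⟨s, rfl, rfl⟩ := rowExp_ne_zero.1 h1
  have hlt : ∀ m, m < s → P m = k + m.rev := by
    intro m hm
    have h2 := hv' (rowVar (k + m.rev) (I m)) (rowVar_lt_rowVar.2 (Or.inl (by
      rw [Fin.lt_def] at hm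
      simp only [Fin.val_rev]
      omega)))
    have h3 : initExp I k (rowVar (k + m.rev) (I m)) ≠ 0 := rowExp_ne_zero.2 ⟨m, rfl, rfl⟩
    rw [h2, rowExp_ne_zero] at h3
    obtain ⟨m', h4, h5⟩ := h3
    rw [← h4, hI.injective h5]
  -- A factor in a row `≥ k + s.rev` at a position `m ≥ s` would be this variable or a larger one; a
  -- larger one would have to occur in the antidiagonal monomial, at position `m`, where the row is
  -- at most `k + s.rev`.
  have hge : ∀ m, s ≤ m → P m < k + s.rev := by
    intro m hm
    by_contra hcon
    rcases (not_lt.1 hcon).eq_or_lt with h2 | h2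
    · rcases hm.eq_or_lt with rfl | hm
      · exact rowExp_ne_zero.2 ⟨s, h2.symm, rfl⟩ h0
      · have h3 := hv' (rowVar (P m) (I m)) (rowVar_lt_rowVar.2 (Or.inr ⟨h2, hI hm⟩))
        have h4 : rowExp P I (rowVar (P m) (I m)) ≠ 0 := rowExp_ne_zero.2 ⟨m, rfl, rfl⟩
        rw [← h3, initExp, rowExp_ne_zero] at h4
        obtain ⟨m', h5, h6⟩ := h4
        have := hI.injective h6
        subst this
        rw [Fin.lt_def] at hm
        simp only [Fin.val_rev] at h5 h2
        omega
    · have h3 := hv' (rowVar (P m) (I m)) (rowVar_lt_rowVar.2 (Or.inl h2))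
      have h4 : rowExp P I (rowVar (P m) (I m)) ≠ 0 := rowExp_ne_zero.2 ⟨m, rfl, rfl⟩
      rw [← h3, initExp, rowExp_ne_zero] at h4
      obtain ⟨m', h5, h6⟩ := h4
      have := hI.injective h6
      subst this
      rw [Fin.le_def] at hm
      simp only [Fin.val_rev] at h5 h2
      omega
  -- The positions from `s` on have distinct row numbers less than `k + s.rev`, so their sum is too
  -- small to equal that of `k, …, k + s.rev`, although all other positions agree.
  have h2 := sum_add_card_le_of_injOn (Finset.Ici s) P (k + s.rev) hP.injOn
    (fun m hm => hge m (Finset.mem_Ici.1 hm))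
  have h3 := sum_rev_Ici s k
  have h4 : ∑ m ∈ Finset.Ici s, P m = ∑ m ∈ Finset.Ici s, (k + (m.rev : ℕ)) := by
    have e1 := Finset.sum_add_sum_compl (Finset.Ici s) P
    have e2 := Finset.sum_add_sum_compl (Finset.Ici s) (fun m : Fin p => k + (m.rev : ℕ))
    have e3 : ∑ m ∈ (Finset.Ici s)ᶜ, P m = ∑ m ∈ (Finset.Ici s)ᶜ, (k + (m.rev : ℕ)) :=
      Finset.sum_congr rfl fun m hm => hlt m (by simpa using hm)
    rw [e3] at e1
    omega
  have h5 : (Finset.Ici s).card = s.rev + 1 := by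
    rw [Fin.card_Ici, Fin.val_rev]
    omega
  have h6 : ∑ i ∈ Finset.range (Finset.Ici s).card, i * 2 =
      (Finset.Ici s).card * ((Finset.Ici s).card - 1) := by
    rw [← Finset.sum_mul, Finset.sum_range_id_mul_two]
  rw [← Finset.sum_mul] at h6
  rw [h4, h3] at h2
  rw [h5] at h2 h6
  simp only [Nat.add_sub_cancel] at h6
  nlinarith

/-- The rows within their blocks of the factors of the initial term of `D_I^{(k)}`. -/
def initPerm (p k : ℕ) [NeZero p] : Equiv.Perm (Fin p) :=
  Equiv.ofBijective (fun m : Fin p => Fin.ofNat p (k + m.rev)) (by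
    refine Finite.injective_iff_bijective.1 fun a b h => ?_
    have h1 : k + (a.rev : ℕ) ≡ k + (b.rev : ℕ) [MOD p] := by
      exact congrArg Fin.val h
    have h2 := Nat.ModEq.add_left_cancel' k h1
    exact Fin.rev_injective (Fin.ext (Nat.ModEq.eq_of_lt_of_lt h2 a.rev.2 b.rev.2)))

/-- The coefficient of the initial term of `D_I^{(k)}`. -/
def initSign (p k : ℕ) [NeZero p] : ℂ := ((Equiv.Perm.sign (initPerm p k) : ℤ) : ℂ)

theorem initSign_ne_zero (k : ℕ) : initSign p k ≠ 0 := by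
  rcases Int.units_eq_one_or (Equiv.Perm.sign (initPerm p k)) with h | h <;>
    simp [initSign, h]

/-- The residues contribute `0 + … + (p - 1)` to both sums. Thus having degree `k` in `t` is a
condition on the sum of the row numbers. -/
theorem sum_row_eq_iff (τ : Equiv.Perm (Fin p)) (l : Fin p → ℕ) (k : ℕ) :
    ∑ m, (p * l m + τ m) = ∑ m : Fin p, (k + (m.rev : ℕ)) ↔ ∑ m, l m = k := by
  have h1 : ∑ m, (τ m : ℕ) = ∑ m : Fin p, (m : ℕ) := Equiv.sum_comp τ (fun m => (m : ℕ))
  have h2 : ∑ m : Fin p, (m.rev : ℕ) = ∑ m : Fin p, (m : ℕ) :=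
    Equiv.sum_comp Fin.revPerm (fun m => (m : ℕ))
  rw [Finset.sum_add_distrib, Finset.sum_add_distrib, h1, h2, ← Finset.mul_sum,
    Finset.sum_const, Finset.card_univ, Fintype.card_fin, smul_eq_mul, add_left_inj,
    Nat.mul_right_inj (NeZero.ne p)]

theorem plueckerD_eq_sum (I : Fin p → Fin n) (k : ℕ) :
    plueckerD I k = ∑ τ : Equiv.Perm (Fin p), ∑ l ∈ Finset.finsuppAntidiag Finset.univ k,
      MvPolynomial.monomial (rowExp (fun m => p * l m + τ m) I)
        ((Equiv.Perm.sign τ : ℤ) : ℂ) := by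
  classical
  rw [plueckerD, Matrix.det_apply, map_sum]
  refine Finset.sum_congr rfl fun τ _ => ?_
  rw [Units.smul_def, map_zsmul, PowerSeries.coeff_prod, Finset.smul_sum]
  refine Finset.sum_congr rfl fun l _ => ?_
  have h1 : ∏ m, PowerSeries.coeff (l m) ((zMatrix n p).submatrix id I (τ m) m) =
      MvPolynomial.monomial (rowExp (fun m => p * l m + τ m) I) (1 : ℂ) := by
    rw [rowExp, MvPolynomial.monomial_sum_one]
    refine Finset.prod_congr rfl fun m _ => ?_
    rw [rowVar_mul_add, Matrix.submatrix_apply, zMatrix, Matrix.of_apply, PowerSeries.coeff_mk]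
    rfl
  rw [h1, ← Int.cast_smul_eq_zsmul ℂ, MvPolynomial.smul_monomial, smul_eq_mul, mul_one]

theorem isLeading_plueckerD {I : Fin p → Fin n} (hI : StrictMono I) (k : ℕ) :
    IsLeading (plueckerD I k) (initExp I k) ∧
      (plueckerD I k).coeff (initExp I k) = initSign p k := by
  classical
  -- Division with remainder of the row numbers by `p` yields the unique summand that produces the
  -- antidiagonal monomial, so its coefficient is a single sign.
  have hrow : ∀ m : Fin p, p * ((k + (m.rev : ℕ)) / p) + (initPerm p k m : ℕ) = k + m.rev :=
    fun m => Nat.div_add_mod _ _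
  have hsum : ∑ m : Fin p, (k + (m.rev : ℕ)) / p = k :=
    (sum_row_eq_iff (initPerm p k) _ k).1 (Finset.sum_congr rfl fun m _ => hrow m)
  have hne : ∀ (τ : Equiv.Perm (Fin p)) (l : Fin p → ℕ),
      rowExp (fun m => p * l m + τ m) I = initExp I k →
      τ = initPerm p k ∧ ∀ m, l m = (k + (m.rev : ℕ)) / p := by
    intro τ l h
    have h1 := rowExp_injective hI.injective h
    have h2 : ∀ m, p * l m + (τ m : ℕ) = k + m.rev := fun m => congrFun h1 m
    constructor
    · ext m
      change (τ m : ℕ) = (k + m.rev) % p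
      rw [← h2 m, Nat.mul_add_mod, Nat.mod_eq_of_lt (τ m).2]
    · intro m
      rw [← h2 m, Nat.mul_add_div (NeZero.pos p), Nat.div_eq_of_lt (τ m).2, add_zero]
  have hcoeff : (plueckerD I k).coeff (initExp I k) = initSign p k := by
    rw [plueckerD_eq_sum, MvPolynomial.coeff_sum, Finset.sum_eq_single (initPerm p k),
      MvPolynomial.coeff_sum,
      Finset.sum_eq_single (Finsupp.equivFunOnFinite.symm fun m => (k + (m.rev : ℕ)) / p)]
    · rw [MvPolynomial.coeff_monomial, if_pos, initSign]
      rw [initExp]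
      congr 1
      funext m
      exact hrow m
    · intro l _ hl
      rw [MvPolynomial.coeff_monomial, if_neg]
      intro h
      exact hl (Finsupp.ext fun m => (hne _ _ h).2 m)
    · intro h
      refine absurd (Finset.mem_finsuppAntidiag.2 ⟨?_, Finset.subset_univ _⟩) h
      simpa using hsum
    · intro τ _ hτ
      rw [MvPolynomial.coeff_sum]
      refine Finset.sum_eq_zero fun l _ => ?_
      rw [MvPolynomial.coeff_monomial, if_neg]
      intro h
      exact hτ (hne _ _ h).1
    · simp
  refine ⟨⟨?_, fun e he hne' => ?_⟩, hcoeff⟩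
  · rw [MvPolynomial.mem_support_iff, hcoeff]
    exact initSign_ne_zero k
  · rw [MvPolynomial.mem_support_iff, plueckerD_eq_sum, MvPolynomial.coeff_sum] at he
    obtain ⟨τ, -, he⟩ := Finset.exists_ne_zero_of_sum_ne_zero he
    rw [MvPolynomial.coeff_sum] at he
    obtain ⟨l, hl, he⟩ := Finset.exists_ne_zero_of_sum_ne_zero he
    rw [MvPolynomial.coeff_monomial] at he
    have he' : rowExp (fun m => p * l m + τ m) I = e := by
      by_contra h
      exact he (if_neg h)
    subst he'
    refine (DegRevLexLT.total hne').resolve_right (not_initExp_lt hI (row_injective τ l) ?_)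
    exact (sum_row_eq_iff τ l k).2 (Finset.mem_finsuppAntidiag.1 hl).1

theorem coe_initialD {I : Fin p → Fin n} (hI : StrictMono I) (k : ℕ) :
    (initialD I k : MvPolynomial (ZVar n p) ℂ) =
      MvPolynomial.monomial (initExp I k) (initSign p k) := by
  rw [← (isLeading_plueckerD hI k).2]
  exact (isLeading_plueckerD hI k).1.initialTerm_eq

end Rows

/-! ### Antisymmetrized products of minors -/

section Exchange

variable {R : Type*} [CommRing R]

/-- If `h` divides `B - A`, then a matrix formed by rows of `A` and rows of `B` has a determinant
divisible by `h` as many times as there are coincidences between their row numbers. -/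
theorem pow_dvd_det_of_dvd_sub {S T ρ : Type*} [Fintype S] [Fintype T] [Fintype ρ] [DecidableEq S]
    [DecidableEq T] (A B : ρ → S ⊕ T → R) (h : R) (hAB : ∀ r c, h ∣ B r c - A r c)
    (f : S → ρ) (g : T → ρ) (hf : Function.Injective f) (hg : Function.Injective g) (c : ℕ)
    (hc : Fintype.card ρ + c ≤ Fintype.card S + Fintype.card T) :
    h ^ c ∣ Matrix.det (Matrix.of (Sum.elim (fun s => A (f s)) (fun t => B (g t)))) := by
  classical
  choose C hC using hAB
  set M := Matrix.of (Sum.elim (fun s => A (f s)) (fun t => B (g t))) with hM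
  -- Multiplication by `U` subtracts from a row of `B` the row of `A` with the same number, if that
  -- is present; the difference is `h` times a row of `C`.
  let N : Matrix T S R := Matrix.of fun t s => if g t = f s then -1 else 0
  let U : Matrix (S ⊕ T) (S ⊕ T) R := Matrix.fromBlocks 1 0 N 1
  have hU : U.det = 1 := by
    simp [U]
  let v : S ⊕ T → R := Sum.elim (fun _ => 1) (fun t => if g t ∈ Set.range f then h else 1)
  let M' : Matrix (S ⊕ T) (S ⊕ T) R := Matrix.of (Sum.elim (fun s => A (f s))
    (fun t => if g t ∈ Set.range f then C (g t) else B (g t)))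
  have hUM : U * M = Matrix.of fun i j => v i * M' i j := by
    ext i j
    rw [Matrix.mul_apply, Fintype.sum_sum_type]
    rcases i with s | t
    · simp [U, v, M', M, Matrix.one_apply]
    · have e1 : ∑ s, U (Sum.inr t) (Sum.inl s) * M (Sum.inl s) j =
          if g t ∈ Set.range f then - A (g t) j else 0 := by
        split_ifs with hr
        · obtain ⟨s, hs⟩ := hr
          rw [Finset.sum_eq_single s]
          · simp [U, N, M, hs]
          · intro s' _ hs'
            have : g t ≠ f s' := fun h' => hs' (hf (h'.symm.trans hs.symm))
            simp [U, N, this]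
          · simp
        · refine Finset.sum_eq_zero fun s _ => ?_
          have : g t ≠ f s := fun h' => hr ⟨s, h'.symm⟩
          simp [U, N, this]
      have e2 : ∑ t', U (Sum.inr t) (Sum.inr t') * M (Sum.inr t') j = B (g t) j := by
        simp [U, M, Matrix.one_apply]
      rw [e1, e2, Matrix.of_apply]
      simp only [v, M', Matrix.of_apply, Sum.elim_inr]
      split_ifs with hr
      · rw [← hC]
        ring
      · ring
  have hdet : M.det = (∏ i, v i) * M'.det := by
    rw [← Matrix.det_mul_column, ← hUM, Matrix.det_mul, hU, one_mul]
  rw [hdet]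
  refine Dvd.dvd.mul_right ?_ _
  rw [Fintype.prod_sum_type]
  simp only [v, Sum.elim_inl, Sum.elim_inr, Finset.prod_const_one, one_mul]
  rw [Finset.prod_ite, Finset.prod_const, Finset.prod_const_one, mul_one]
  apply pow_dvd_pow
  -- The rows of `B` without a partner and the rows of `A` have pairwise different numbers, which
  -- leaves at least `c` rows of `B` with a partner.
  have h1 : (Finset.univ.filter fun t => ¬ g t ∈ Set.range f).card + Fintype.card S ≤
      Fintype.card ρ := by
    rw [← Finset.card_map ⟨g, hg⟩, ← Finset.card_univ (α := S), ← Finset.card_map ⟨f, hf⟩,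
      ← Finset.card_union_of_disjoint]
    · exact Finset.card_le_univ _
    · rw [Finset.disjoint_left]
      intro r hr hr'
      simp only [Finset.mem_map, Finset.mem_filter, Finset.mem_univ, true_and,
        Function.Embedding.coeFn_mk] at hr hr'
      obtain ⟨t, ht, rfl⟩ := hr
      exact ht hr'
  have h2 := Finset.card_filter_add_card_filter_not (s := Finset.univ) (fun t => g t ∈ Set.range f)
  rw [Finset.card_univ] at h2
  omega

variable {p n : ℕ} (P Q : Fin p → Prop) [DecidablePred P] [DecidablePred Q]
  (I J : Fin p → Fin n)

/-- The columns that take part in an exchange between `I` and `J`: those of `I` at the positions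
in `P` and those of `J` at the positions in `Q`. -/
def exchangeCol : {m // P m} ⊕ {m // Q m} → Fin n :=
  Sum.elim (fun m => I m) (fun m => J m)

variable {P Q}

/-- The tuple `I` after a permutation of the exchanged columns. -/
def exchangeLeft (π : Equiv.Perm ({m // P m} ⊕ {m // Q m})) (m : Fin p) : Fin n :=
  if h : P m then exchangeCol P Q I J (π (Sum.inl ⟨m, h⟩)) else I m

/-- The tuple `J` after a permutation of the exchanged columns. -/
def exchangeRight (π : Equiv.Perm ({m // P m} ⊕ {m // Q m})) (m : Fin p) : Fin n :=
  if h : Q m then exchangeCol P Q I J (π (Sum.inr ⟨m, h⟩)) else J m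

omit [DecidablePred Q] in
theorem prod_exchangeLeft {M : Type*} [CommMonoid M] (F : Fin p → Fin n → M)
    (π : Equiv.Perm ({m // P m} ⊕ {m // Q m})) :
    ∏ m, F m (exchangeLeft I J π m) =
      (∏ x : {m // P m}, F x (exchangeCol P Q I J (π (Sum.inl x)))) *
        ∏ x : {m // ¬ P m}, F x (I x) := by
  rw [← Fintype.prod_subtype_mul_prod_subtype P]
  congr 1
  · refine Finset.prod_congr rfl fun x _ => ?_
    rw [exchangeLeft, dif_pos x.2]
  · refine Finset.prod_congr rfl fun x _ => ?_
    rw [exchangeLeft, dif_neg x.2]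

omit [DecidablePred P] in
theorem prod_exchangeRight {M : Type*} [CommMonoid M] (F : Fin p → Fin n → M)
    (π : Equiv.Perm ({m // P m} ⊕ {m // Q m})) :
    ∏ m, F m (exchangeRight I J π m) =
      (∏ x : {m // Q m}, F x (exchangeCol P Q I J (π (Sum.inr x)))) *
        ∏ x : {m // ¬ Q m}, F x (J x) := by
  rw [← Fintype.prod_subtype_mul_prod_subtype Q]
  congr 1
  · refine Finset.prod_congr rfl fun x _ => ?_
    rw [exchangeRight, dif_pos x.2]
  · refine Finset.prod_congr rfl fun x _ => ?_
    rw [exchangeRight, dif_neg x.2]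

/-- The antisymmetrization of a product of minors of `A` and `B` over more than `p` columns is
divisible by powers of any common divisor of the entries of `B - A`. -/
theorem pow_dvd_sum_exchange (A B : Matrix (Fin p) (Fin n) R) (h : R)
    (hAB : ∀ r c, h ∣ B r c - A r c) (c : ℕ)
    (hc : p + c ≤ Fintype.card {m // P m} + Fintype.card {m // Q m}) :
    h ^ c ∣ ∑ π : Equiv.Perm ({m // P m} ⊕ {m // Q m}), ((Equiv.Perm.sign π : ℤ) : R) *
      ((A.submatrix id (exchangeLeft I J π)).det * (B.submatrix id (exchangeRight I J π)).det) := by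
  -- After expanding both minors, for fixed `τ₁`, `τ₂` the signed sum over `π` is a single
  -- determinant made of rows of `A` and of `B`. Only `p` row numbers are available, so some
  -- coincide.
  have key : ∑ π : Equiv.Perm ({m // P m} ⊕ {m // Q m}), ((Equiv.Perm.sign π : ℤ) : R) *
      ((A.submatrix id (exchangeLeft I J π)).det * (B.submatrix id (exchangeRight I J π)).det) =
      ∑ τ₁ : Equiv.Perm (Fin p), ∑ τ₂ : Equiv.Perm (Fin p),
        (((Equiv.Perm.sign τ₁ : ℤ) : R) * ((Equiv.Perm.sign τ₂ : ℤ) : R) *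
          (∏ x : {m // ¬ P m}, A (τ₁ x) (I x)) * (∏ x : {m // ¬ Q m}, B (τ₂ x) (J x))) *
        Matrix.det (Matrix.of (Sum.elim
          (fun (s : {m // P m}) x => A (τ₁ s) (exchangeCol P Q I J x))
          (fun (t : {m // Q m}) x => B (τ₂ t) (exchangeCol P Q I J x)))) := by
    have e : ∀ π : Equiv.Perm ({m // P m} ⊕ {m // Q m}),
        ((Equiv.Perm.sign π : ℤ) : R) *
          ((A.submatrix id (exchangeLeft I J π)).det *
            (B.submatrix id (exchangeRight I J π)).det) =
        ∑ τ₁ : Equiv.Perm (Fin p), ∑ τ₂ : Equiv.Perm (Fin p),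
          (((Equiv.Perm.sign τ₁ : ℤ) : R) * ((Equiv.Perm.sign τ₂ : ℤ) : R) *
          (∏ x : {m // ¬ P m}, A (τ₁ x) (I x)) * (∏ x : {m // ¬ Q m}, B (τ₂ x) (J x))) *
          (((Equiv.Perm.sign π : ℤ) : R) *
            ((∏ x : {m // P m}, A (τ₁ x) (exchangeCol P Q I J (π (Sum.inl x)))) *
              ∏ x : {m // Q m}, B (τ₂ x) (exchangeCol P Q I J (π (Sum.inr x))))) := by
      intro π
      rw [Matrix.det_apply', Matrix.det_apply', Finset.sum_mul_sum, Finset.mul_sum]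
      refine Finset.sum_congr rfl fun τ₁ _ => ?_
      rw [Finset.mul_sum]
      refine Finset.sum_congr rfl fun τ₂ _ => ?_
      simp only [Matrix.submatrix_apply, id]
      rw [prod_exchangeLeft I J (fun m c => A (τ₁ m) c) π,
        prod_exchangeRight I J (fun m c => B (τ₂ m) c) π]
      ring
    rw [Finset.sum_congr rfl fun π _ => e π, Finset.sum_comm]
    refine Finset.sum_congr rfl fun τ₁ _ => ?_
    rw [Finset.sum_comm]
    refine Finset.sum_congr rfl fun τ₂ _ => ?_
    rw [← Finset.mul_sum, ← Matrix.det_transpose, Matrix.det_apply']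
    congr 1
    refine Finset.sum_congr rfl fun π _ => ?_
    rw [Fintype.prod_sum_type]
    rfl
  rw [key]
  refine Finset.dvd_sum fun τ₁ _ => Finset.dvd_sum fun τ₂ _ => Dvd.dvd.mul_left ?_ _
  refine pow_dvd_det_of_dvd_sub (fun r x => A r (exchangeCol P Q I J x))
    (fun r x => B r (exchangeCol P Q I J x)) h (fun r x => hAB _ _)
    (fun s : {m // P m} => τ₁ s) (fun t : {m // Q m} => τ₂ t)
    (τ₁.injective.comp Subtype.val_injective) (τ₂.injective.comp Subtype.val_injective) c ?_
  rwa [Fintype.card_fin]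

theorem sum_exchange (π : Equiv.Perm ({m // P m} ⊕ {m // Q m})) :
    ∑ m, (exchangeLeft I J π m : ℕ) + ∑ m, (exchangeRight I J π m : ℕ) =
      ∑ m, (I m : ℕ) + ∑ m, (J m : ℕ) := by
  have key : ∀ π : Equiv.Perm ({m // P m} ⊕ {m // Q m}),
      ∑ m, (exchangeLeft I J π m : ℕ) + ∑ m, (exchangeRight I J π m : ℕ) =
        ∑ x, (exchangeCol P Q I J x : ℕ) +
          (∑ x : {m // ¬ P m}, (I x : ℕ) + ∑ x : {m // ¬ Q m}, (J x : ℕ)) := by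
    intro π
    -- `Multiplicative ℕ` turns the product formula into one for sums.
    have h1 := prod_exchangeLeft (M := Multiplicative ℕ) I J
      (fun _ c => Multiplicative.ofAdd (c : ℕ)) π
    have h2 := prod_exchangeRight (M := Multiplicative ℕ) I J
      (fun _ c => Multiplicative.ofAdd (c : ℕ)) π
    simp only [← ofAdd_sum, ← ofAdd_add, EmbeddingLike.apply_eq_iff_eq] at h1 h2
    rw [h1, h2, ← Equiv.sum_comp π, Fintype.sum_sum_type]
    ring
  rw [key π, ← key 1]
  congr 1 <;> refine Finset.sum_congr rfl fun m _ => ?_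
  · rw [exchangeLeft]
    split_ifs <;> rfl
  · rw [exchangeRight]
    split_ifs <;> rfl

/-- The common part cancels, and every value on `S' \ S` is less than the minimum on the equally
large set `S \ S'`. -/
theorem sum_lt_sum_of_card_eq {ι : Type*} [DecidableEq ι] (S S' : Finset ι) (c : ι → ℕ)
    (hcard : S'.card = S.card) (hne : S' ≠ S) (hc : ∀ x ∈ S, ∀ y ∉ S, c y < c x) :
    ∑ x ∈ S', c x < ∑ x ∈ S, c x := by
  have h1 : (S' \ S).card = (S \ S').card := by
    have e1 := Finset.card_sdiff_add_card_inter S S'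
    have e2 := Finset.card_sdiff_add_card_inter S' S
    rw [Finset.inter_comm] at e2
    omega
  have hn : (S' \ S).Nonempty := by
    rw [Finset.sdiff_nonempty]
    exact fun h => hne (Finset.eq_of_subset_of_card_le h hcard.ge)
  have hn' : (S \ S').Nonempty := by
    rw [← Finset.card_pos, ← h1, Finset.card_pos]
    exact hn
  obtain ⟨x, hx, hmin⟩ := Finset.exists_min_image _ c hn'
  rw [← Finset.sum_inter_add_sum_sdiff S' S, ← Finset.sum_inter_add_sum_sdiff S S',
    Finset.inter_comm]
  refine Nat.add_lt_add_left ?_ _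
  calc ∑ y ∈ S' \ S, c y < ∑ y ∈ S' \ S, c x := Finset.sum_lt_sum_of_nonempty hn fun y hy =>
        hc x (Finset.mem_sdiff.1 hx).1 y (Finset.mem_sdiff.1 hy).2
    _ = ∑ y ∈ S \ S', c x := by rw [Finset.sum_const, Finset.sum_const, h1]
    _ ≤ ∑ y ∈ S \ S', c y := Finset.sum_le_sum fun y hy => hmin y hy

-- All exchanged columns of `I` exceed those of `J`, so moving any column of `J` to the left lowers
-- the column sum there.
omit [DecidablePred Q] in
theorem sum_exchangeLeft_lt (π : Equiv.Perm ({m // P m} ⊕ {m // Q m}))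
    (hIJ : ∀ a b, P a → Q b → J b < I a)
    (hπ : ¬ Set.MapsTo π (Set.range Sum.inl) (Set.range Sum.inl)) :
    ∑ m, (exchangeLeft I J π m : ℕ) < ∑ m, (I m : ℕ) := by
  classical
  have key : ∀ π : Equiv.Perm ({m // P m} ⊕ {m // Q m}),
      ∑ m, (exchangeLeft I J π m : ℕ) =
        ∑ x ∈ (Finset.univ.map (Function.Embedding.inl : {m // P m} ↪ _)).map π.toEmbedding,
          (exchangeCol P Q I J x : ℕ) + ∑ x : {m // ¬ P m}, (I x : ℕ) := by
    intro π
    have h1 := prod_exchangeLeft (M := Multiplicative ℕ) I J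
      (fun _ c => Multiplicative.ofAdd (c : ℕ)) π
    simp only [← ofAdd_sum, ← ofAdd_add, EmbeddingLike.apply_eq_iff_eq] at h1
    rw [h1, Finset.sum_map, Finset.sum_map]
    rfl
  have h1 : ∑ m, (I m : ℕ) =
      ∑ m, (exchangeLeft I J (1 : Equiv.Perm ({m // P m} ⊕ {m // Q m})) m : ℕ) := by
    refine Finset.sum_congr rfl fun m _ => ?_
    rw [exchangeLeft]
    split_ifs <;> rfl
  rw [h1, key, key]
  refine Nat.add_lt_add_right ?_ _
  have h2 : (Finset.univ.map (Function.Embedding.inl : {m // P m} ↪ {m // P m} ⊕ {m // Q m})).map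
      (1 : Equiv.Perm ({m // P m} ⊕ {m // Q m})).toEmbedding =
      Finset.univ.map Function.Embedding.inl := Finset.map_refl
  rw [h2]
  refine sum_lt_sum_of_card_eq _ _ _ (by simp) ?_ ?_
  · intro h
    apply hπ
    rintro _ ⟨x, rfl⟩
    have h3 : π (Sum.inl x) ∈ (Finset.univ.map
        (Function.Embedding.inl : {m // P m} ↪ {m // P m} ⊕ {m // Q m})).map π.toEmbedding := by
      simp
    rw [h] at h3
    simpa using h3
  · rintro x hx y hy
    rcases x with x | x
    · rcases y with y | y
      · simp at hy
      · exact hIJ x y x.2 y.2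
    · simp at hx

end Exchange

/-! ### Quadratic relations and straightening -/

/-- A polynomial divisible by `(X - 1) ^ (d + 1)` is annihilated by the functionals that weigh the
coefficients by a polynomial of degree `d` in their index. -/
theorem sum_prod_sub_smul_coeff_eq_zero {R : Type*} [CommRing R] [Algebra ℂ R] (w : ℕ → ℂ) (N : ℕ)
    (d : ℕ) (G : Polynomial R) (hN : G.natDegree ≤ N)
    (hG : (Polynomial.X - 1 : Polynomial R) ^ (d + 1) ∣ G) :
    ∑ y ∈ Finset.range (N + 1), (∏ j ∈ Finset.range d, ((y : ℂ) - w j)) • G.coeff y = 0 := by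
  induction d generalizing G with
  | zero =>
    obtain ⟨H, rfl⟩ := hG
    have h := Polynomial.eval_eq_sum_range' (Nat.lt_succ_of_le hN) (1 : R)
    simp only [Polynomial.eval_mul, Polynomial.eval_pow, Polynomial.eval_sub, Polynomial.eval_X,
      Polynomial.eval_one, sub_self, one_pow, mul_one] at h
    simpa using h.symm
  | succ d ih =>
    -- The operator `X · d/dX - w d` multiplies the coefficient of `X ^ y` by `y - w d` and costs
    -- one factor `X - 1`.
    let G' := Polynomial.X * Polynomial.derivative G - Polynomial.C (algebraMap ℂ R (w d)) * G
    have hcoeff : ∀ y, G'.coeff y = ((y : ℂ) - w d) • G.coeff y := by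
      intro y
      rw [Polynomial.coeff_sub, Polynomial.coeff_C_mul, sub_smul, Algebra.smul_def (w d)]
      congr 1
      rcases y with _ | y
      · simp
      · rw [Polynomial.coeff_X_mul, Polynomial.coeff_derivative, Algebra.smul_def]
        simp [mul_comm]
    have hdeg : G'.natDegree ≤ N := by
      rw [Polynomial.natDegree_le_iff_coeff_eq_zero]
      intro y hy
      rw [hcoeff, Polynomial.coeff_eq_zero_of_natDegree_lt (hN.trans_lt hy), smul_zero]
    have hdvd : (Polynomial.X - 1 : Polynomial R) ^ (d + 1) ∣ G' := by
      refine dvd_sub (Dvd.dvd.mul_left ?_ _) (Dvd.dvd.mul_left ((pow_dvd_pow _ (by omega)).trans hG) _)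
      obtain ⟨H, rfl⟩ := hG
      rw [Polynomial.derivative_mul, Polynomial.derivative_pow]
      refine dvd_add (Dvd.dvd.mul_right ?_ _) (Dvd.dvd.mul_right (pow_dvd_pow _ (by omega)) _)
      exact Dvd.dvd.mul_right (Dvd.intro_left _ rfl) _
    have h := ih G' hdeg hdvd
    rw [← h]
    refine Finset.sum_congr rfl fun y _ => ?_
    rw [hcoeff, Finset.prod_range_succ, mul_smul]

variable {n p : ℕ}

/-- The weight of `D_I^{(k)}`: straightening spreads the weights of two factors apart. -/
def weight (I : Fin p → Fin n) (k : ℕ) : ℕ := (2 * (p * n) + 1) * k + ∑ m, (I m : ℕ)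

theorem sum_val_le (I : Fin p → Fin n) : ∑ m, (I m : ℕ) ≤ p * n := by
  calc ∑ m, (I m : ℕ) ≤ ∑ _m : Fin p, n := Finset.sum_le_sum fun m _ => (I m).2.le
    _ = p * n := by simp

theorem plueckerD_comp_perm (I : Fin p → Fin n) (τ : Equiv.Perm (Fin p)) (k : ℕ) :
    plueckerD (I ∘ τ) k = ((Equiv.Perm.sign τ : ℤ) : MvPolynomial (ZVar n p) ℂ) * plueckerD I k := by
  have h := Matrix.det_permute' τ ((zMatrix n p).submatrix id I)
  rw [Matrix.submatrix_submatrix, Function.comp_id] at h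
  rw [plueckerD, plueckerD, h, ← zsmul_eq_mul, map_zsmul, zsmul_eq_mul]

theorem plueckerD_eq_zero (I : Fin p → Fin n) (k : ℕ) (hI : ¬ Function.Injective I) :
    plueckerD I k = 0 := by
  rw [Function.not_injective_iff] at hI
  obtain ⟨a, b, hab, hne⟩ := hI
  rw [plueckerD, Matrix.det_zero_of_column_eq hne, map_zero]
  intro i
  rw [Matrix.submatrix_apply, Matrix.submatrix_apply, hab]

/-- The generating polynomial of the products `D_I^{(x)} D_J^{(y)}` with `x + y = K`. -/
def productPolynomial (I J : Fin p → Fin n) (K : ℕ) : Polynomial (MvPolynomial (ZVar n p) ℂ) :=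
  ∑ y ∈ Finset.range (K + 1), Polynomial.monomial y (plueckerD I (K - y) * plueckerD J y)

theorem coeff_productPolynomial (I J : Fin p → Fin n) {K y : ℕ} (hy : y ≤ K) :
    (productPolynomial I J K).coeff y = plueckerD I (K - y) * plueckerD J y := by
  rw [productPolynomial, Polynomial.finsetSum_coeff, Finset.sum_eq_single y]
  · rw [Polynomial.coeff_monomial, if_pos rfl]
  · intro b _ hb
    rw [Polynomial.coeff_monomial, if_neg hb]
  · intro h
    exact absurd (Finset.mem_range.2 (Nat.lt_succ_of_le hy)) h

theorem natDegree_productPolynomial_le (I J : Fin p → Fin n) (K : ℕ) :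
    (productPolynomial I J K).natDegree ≤ K := by
  refine Polynomial.natDegree_sum_le_of_forall_le _ _ fun y hy => ?_
  exact (Polynomial.natDegree_monomial_le _).trans (Nat.le_of_lt_succ (Finset.mem_range.1 hy))

/-- The matrix `Z(t)` over a larger coefficient ring. -/
def zMatrixBase (n p : ℕ) : Matrix (Fin p) (Fin n)
    (PowerSeries (Polynomial (MvPolynomial (ZVar n p) ℂ))) :=
  (zMatrix n p).map (PowerSeries.map Polynomial.C)

/-- The matrix `Z(λ t)`, where `λ` is a variable. -/
def zMatrixScaled (n p : ℕ) : Matrix (Fin p) (Fin n)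
    (PowerSeries (Polynomial (MvPolynomial (ZVar n p) ℂ))) :=
  (zMatrixBase n p).map (PowerSeries.rescale Polynomial.X)

/-- The coefficient of `t ^ k` in the difference carries the factor `λ ^ k - 1`. -/
theorem dvd_zMatrixScaled_sub (i : Fin p) (j : Fin n) :
    PowerSeries.C (Polynomial.X - 1) ∣ zMatrixScaled n p i j - zMatrixBase n p i j := by
  refine ⟨PowerSeries.mk fun k => (∑ i ∈ Finset.range k, Polynomial.X ^ i) *
    Polynomial.C (zvar k i j), ?_⟩
  ext1 k
  rw [map_sub, PowerSeries.coeff_C_mul, PowerSeries.coeff_mk, ← mul_assoc, mul_geom_sum, sub_mul,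
    one_mul]
  simp [zMatrixScaled, zMatrixBase, zMatrix]

/-- Only the second minor is rescaled, so the power of `λ` records its degree in `t`. -/
theorem coeff_det_mul_det (I J : Fin p → Fin n) (K : ℕ) :
    PowerSeries.coeff K (((zMatrixBase n p).submatrix id I).det *
      ((zMatrixScaled n p).submatrix id J).det) = productPolynomial I J K := by
  have h1 : ((zMatrixBase n p).submatrix id I).det =
      PowerSeries.map Polynomial.C ((zMatrix n p).submatrix id I).det := by
    rw [RingHom.map_det]
    rfl
  have h2 : ((zMatrixScaled n p).submatrix id J).det = PowerSeries.rescale Polynomial.X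
      (PowerSeries.map Polynomial.C ((zMatrix n p).submatrix id J).det) := by
    rw [RingHom.map_det, RingHom.map_det]
    rfl
  rw [h1, h2, PowerSeries.coeff_mul, ← Finset.Nat.sum_antidiagonal_swap,
    Finset.Nat.sum_antidiagonal_eq_sum_range_succ_mk, productPolynomial]
  refine Finset.sum_congr rfl fun y _ => ?_
  simp only [Prod.swap_prod_mk, PowerSeries.coeff_map, PowerSeries.coeff_rescale]
  rw [← Polynomial.C_mul_X_pow_eq_monomial, Polynomial.C_mul]
  simp only [plueckerD]
  ring

/-- The quadratic relations between the `D_I^{(k)}`. -/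
theorem sum_smul_exchange_eq_zero {P Q : Fin p → Prop} [DecidablePred P] [DecidablePred Q]
    (I J : Fin p → Fin n) (d : ℕ)
    (hd : p + (d + 1) ≤ Fintype.card {m // P m} + Fintype.card {m // Q m}) (w : ℕ → ℂ) (K : ℕ) :
    ∑ y ∈ Finset.range (K + 1), (∏ j ∈ Finset.range d, ((y : ℂ) - w j)) •
      ∑ π : Equiv.Perm ({m // P m} ⊕ {m // Q m}),
        ((Equiv.Perm.sign π : ℤ) : MvPolynomial (ZVar n p) ℂ) *
          (plueckerD (exchangeLeft I J π) (K - y) * plueckerD (exchangeRight I J π) y) = 0 := by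
  let G : Polynomial (MvPolynomial (ZVar n p) ℂ) :=
    ∑ π : Equiv.Perm ({m // P m} ⊕ {m // Q m}),
      ((Equiv.Perm.sign π : ℤ) : Polynomial (MvPolynomial (ZVar n p) ℂ)) *
        productPolynomial (exchangeLeft I J π) (exchangeRight I J π) K
  have hG : (Polynomial.X - 1) ^ (d + 1) ∣ G := by
    obtain ⟨H, hH⟩ := pow_dvd_sum_exchange I J (zMatrixBase n p) (zMatrixScaled n p) _
      dvd_zMatrixScaled_sub (d + 1) hd
    have h := congrArg (PowerSeries.coeff K) hH
    rw [← map_pow, PowerSeries.coeff_C_mul, map_sum] at h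
    refine ⟨PowerSeries.coeff K H, ?_⟩
    rw [← h]
    refine Finset.sum_congr rfl fun π _ => ?_
    rw [← coeff_det_mul_det, ← zsmul_eq_mul, ← zsmul_eq_mul, map_zsmul]
  have hdeg : G.natDegree ≤ K := by
    refine Polynomial.natDegree_sum_le_of_forall_le _ _ fun π _ => ?_
    rw [← zsmul_eq_mul]
    exact (Polynomial.natDegree_smul_le _ _).trans (natDegree_productPolynomial_le _ _ K)
  have h := sum_prod_sub_smul_coeff_eq_zero w K d G hdeg hG
  rw [← h]
  refine Finset.sum_congr rfl fun y hy => ?_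
  congr 1
  rw [Polynomial.finsetSum_coeff]
  refine Finset.sum_congr rfl fun π _ => ?_
  rw [← zsmul_eq_mul, ← zsmul_eq_mul, Polynomial.coeff_smul,
    coeff_productPolynomial _ _ (Nat.le_of_lt_succ (Finset.mem_range.1 hy))]

theorem exchangeLeft_sumCongr {P Q : Fin p → Prop} [DecidablePred P] [DecidablePred Q]
    (I J : Fin p → Fin n) (τ₁ : Equiv.Perm {m // P m}) (τ₂ : Equiv.Perm {m // Q m}) :
    exchangeLeft I J (Equiv.sumCongr τ₁ τ₂) = I ∘ Equiv.Perm.ofSubtype τ₁ := by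
  funext m
  rw [exchangeLeft, Function.comp_apply]
  split_ifs with h
  · rw [Equiv.Perm.ofSubtype_apply_of_mem τ₁ h]
    rfl
  · rw [Equiv.Perm.ofSubtype_apply_of_not_mem τ₁ h]

theorem exchangeRight_sumCongr {P Q : Fin p → Prop} [DecidablePred P] [DecidablePred Q]
    (I J : Fin p → Fin n) (τ₁ : Equiv.Perm {m // P m}) (τ₂ : Equiv.Perm {m // Q m}) :
    exchangeRight I J (Equiv.sumCongr τ₁ τ₂) = J ∘ Equiv.Perm.ofSubtype τ₂ := by
  funext m
  rw [exchangeRight, Function.comp_apply]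
  split_ifs with h
  · rw [Equiv.Perm.ofSubtype_apply_of_mem τ₂ h]
    rfl
  · rw [Equiv.Perm.ofSubtype_apply_of_not_mem τ₂ h]

/-- Such a permutation acts on each side separately, and its sign cancels against those from
reordering the columns of the two minors. -/
theorem sign_mul_exchange_of_mapsTo {P Q : Fin p → Prop} [DecidablePred P] [DecidablePred Q]
    (I J : Fin p → Fin n) (a b : ℕ) (π : Equiv.Perm ({m // P m} ⊕ {m // Q m}))
    (hπ : Set.MapsTo π (Set.range Sum.inl) (Set.range Sum.inl)) :
    ((Equiv.Perm.sign π : ℤ) : MvPolynomial (ZVar n p) ℂ) *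
      (plueckerD (exchangeLeft I J π) a * plueckerD (exchangeRight I J π) b) =
        plueckerD I a * plueckerD J b := by
  obtain ⟨⟨τ₁, τ₂⟩, rfl⟩ := Equiv.Perm.mem_sumCongrHom_range_of_perm_mapsTo_inl hπ
  have h : Equiv.Perm.sumCongrHom _ _ (τ₁, τ₂) = Equiv.sumCongr τ₁ τ₂ := rfl
  rw [h, exchangeLeft_sumCongr, exchangeRight_sumCongr, plueckerD_comp_perm, plueckerD_comp_perm,
    Equiv.Perm.sign_sumCongr, Equiv.Perm.sign_ofSubtype, Equiv.Perm.sign_ofSubtype]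
  rcases Int.units_eq_one_or (Equiv.Perm.sign τ₁) with h₁ | h₁ <;>
  rcases Int.units_eq_one_or (Equiv.Perm.sign τ₂) with h₂ | h₂ <;> simp [h₁, h₂]

theorem sq_add_sq_lt_of_spread {w₁ w₂ v₁ v₂ : ℤ} (hsum : v₁ + v₂ = w₁ + w₂)
    (h : |w₂ - w₁| < |v₂ - v₁|) : w₁ ^ 2 + w₂ ^ 2 < v₁ ^ 2 + v₂ ^ 2 := by
  have h1 := sq_lt_sq.2 h
  have h2 : v₁ = w₁ + w₂ - v₂ := by omega
  subst h2
  nlinarith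

/-- A product of two `D_I^{(k)}` that is not standard is a combination of products with weights
further apart. -/
theorem plueckerD_mul_plueckerD_mem {I J : Fin p → Fin n} (hI : StrictMono I) (hJ : StrictMono J)
    {a b : ℕ} (hab : a ≤ b) (hIJ : a = b → ∑ m, (I m : ℕ) ≤ ∑ m, (J m : ℕ))
    {i j : Fin p} (hij : (i : ℕ) + (b - a) = j) (hlt : J j < I i)
    (V : Submodule ℂ (MvPolynomial (ZVar n p) ℂ))
    (hV : ∀ I' J' a' b', weight I' a' + weight J' b' = weight I a + weight J b →
      (weight I a) ^ 2 + (weight J b) ^ 2 < (weight I' a') ^ 2 + (weight J' b') ^ 2 →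
      plueckerD I' a' * plueckerD J' b' ∈ V) :
    plueckerD I a * plueckerD J b ∈ V := by
  classical
  -- The exchange involves `(p - i) + (j + 1) = p + (b - a) + 1` columns, just enough for relations
  -- weighted by polynomials of degree `b - a`.
  let P : Fin p → Prop := fun m => i ≤ m
  let Q : Fin p → Prop := fun m => m ≤ j
  have hcard : p + ((b - a) + 1) ≤ Fintype.card {m // P m} + Fintype.card {m // Q m} := by
    have h1 : Fintype.card {m // P m} = p - i := by
      rw [Fintype.card_subtype, ← Fin.card_Ici]
      congr 1
      ext m
      simp [P]
    have h2 : Fintype.card {m // Q m} = j + 1 := by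
      rw [Fintype.card_subtype, ← Fin.card_Iic]
      congr 1
      ext m
      simp [Q]
    omega
  have hPQ : ∀ x y, P x → Q y → J y < I x := fun x y hx hy =>
    (hJ.monotone hy).trans_lt (hlt.trans_le (hI.monotone hx))
  let E : ℕ → MvPolynomial (ZVar n p) ℂ := fun y =>
    ∑ π : Equiv.Perm ({m // P m} ⊕ {m // Q m}),
      ((Equiv.Perm.sign π : ℤ) : MvPolynomial (ZVar n p) ℂ) *
        (plueckerD (exchangeLeft I J π) (a + b - y) * plueckerD (exchangeRight I J π) y)
  -- The roots `a, …, b - 1` of the weighting polynomial remove these values of `y`. What remains is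
  -- `y = b`, with nonzero coefficient, and degrees further apart than `a` and `b`.
  have hrel : ∑ y ∈ Finset.range (a + b + 1),
      (∏ l ∈ Finset.range (b - a), ((y : ℂ) - ((a + l : ℕ) : ℂ))) • E y = 0 :=
    sum_smul_exchange_eq_zero I J (b - a) hcard (fun l => ((a + l : ℕ) : ℂ)) (a + b)
  have hsumI := sum_val_le I
  have hsumJ := sum_val_le J
  have hmem : ∀ (π : Equiv.Perm ({m // P m} ⊕ {m // Q m})) (x y : ℕ), x + y = a + b →
      (y < a ∨ b < y) →
      plueckerD (exchangeLeft I J π) x * plueckerD (exchangeRight I J π) y ∈ V := by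
    intro π x y hxy hy
    have h1 := sum_exchange I J π
    have h2 := sum_val_le (exchangeLeft I J π)
    have h3 := sum_val_le (exchangeRight I J π)
    have h4 : weight (exchangeLeft I J π) x + weight (exchangeRight I J π) y =
        weight I a + weight J b := by
      simp only [weight]
      have h5 : (2 * (p * n) + 1) * x + (2 * (p * n) + 1) * y =
        (2 * (p * n) + 1) * a + (2 * (p * n) + 1) * b := by rw [← mul_add, hxy, mul_add]
      omega
    refine hV _ _ _ _ h4 ?_
    zify
    refine sq_add_sq_lt_of_spread (by exact_mod_cast h4) ?_
    -- Column sums lie between `0` and `pn`, so they change the difference of the weights by at most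
    -- `pn` before and after the exchange. The factor `2pn + 1` in the weight makes the larger gap
    -- between the degrees prevail.
    have h6 : |((weight J b : ℕ) : ℤ) - (weight I a : ℕ)| ≤
        (2 * (p * n : ℕ) + 1) * ((b : ℤ) - a) + (p * n : ℕ) := by
      simp only [weight, abs_le]
      push_cast
      zify at hsumI hsumJ hab
      have h7 : (0 : ℤ) ≤ ∑ m, (I m : ℤ) := Finset.sum_nonneg fun m _ => by positivity
      have h8 : (0 : ℤ) ≤ ∑ m, (J m : ℤ) := Finset.sum_nonneg fun m _ => by positivity
      have h9 : (0 : ℤ) ≤ (2 * (p * n) + 1) * ((b : ℤ) - a) :=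
        mul_nonneg (by positivity) (by omega)
      constructor <;> nlinarith
    refine lt_of_le_of_lt h6 ?_
    simp only [weight]
    push_cast
    zify at h2 h3 hab
    have h7 : (0 : ℤ) ≤ ∑ m, (exchangeLeft I J π m : ℤ) :=
      Finset.sum_nonneg fun m _ => by positivity
    have h8 : (0 : ℤ) ≤ ∑ m, (exchangeRight I J π m : ℤ) :=
      Finset.sum_nonneg fun m _ => by positivity
    have hpn : (0 : ℤ) ≤ (p : ℤ) * n := by positivity
    rw [lt_abs]
    rcases hy with hy | hy
    · right
      have h10 : (2 * ((p : ℤ) * n) + 1) * (b - a + 1) ≤ (2 * (p * n) + 1) * ((x : ℤ) - y) :=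
        mul_le_mul_of_nonneg_left (by omega) (by positivity)
      nlinarith
    · left
      have h10 : (2 * ((p : ℤ) * n) + 1) * (b - a + 1) ≤ (2 * (p * n) + 1) * ((y : ℤ) - x) :=
        mul_le_mul_of_nonneg_left (by omega) (by positivity)
      nlinarith
  -- For `y = b` the degrees stay the same, but the left factor, whose weight is already the smaller
  -- or equal one, loses column sum to the right factor.
  have hmem' : ∀ π : Equiv.Perm ({m // P m} ⊕ {m // Q m}),
      ¬ Set.MapsTo π (Set.range Sum.inl) (Set.range Sum.inl) →
      plueckerD (exchangeLeft I J π) a * plueckerD (exchangeRight I J π) b ∈ V := by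
    intro π hπ
    have h1 := sum_exchange I J π
    have h2 := sum_exchangeLeft_lt I J π hPQ hπ
    have h4 : weight (exchangeLeft I J π) a + weight (exchangeRight I J π) b =
        weight I a + weight J b := by
      simp only [weight]
      omega
    refine hV _ _ _ _ h4 ?_
    zify
    refine sq_add_sq_lt_of_spread (by exact_mod_cast h4) ?_
    have h5 : weight I a ≤ weight J b := by
      simp only [weight]
      rcases hab.eq_or_lt with h | h
      · have := hIJ h
        rw [h]
        omega
      · have h6 : (2 * (p * n) + 1) * (a + 1) ≤ (2 * (p * n) + 1) * b :=
          Nat.mul_le_mul_left _ h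
        have h7 := Nat.zero_le (∑ m, (J m : ℕ))
        have h8 := Nat.zero_le (p * n)
        nlinarith
    have h6 : weight (exchangeLeft I J π) a < weight I a := by
      simp only [weight]
      omega
    rw [abs_of_nonneg (by omega), abs_of_nonneg (by omega)]
    omega
  have hsmul : ∀ (π : Equiv.Perm ({m // P m} ⊕ {m // Q m})) (f : MvPolynomial (ZVar n p) ℂ),
      f ∈ V → ((Equiv.Perm.sign π : ℤ) : MvPolynomial (ZVar n p) ℂ) * f ∈ V := by
    intro π f hf
    rw [← zsmul_eq_mul]
    exact zsmul_mem hf _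
  have hE : ∀ y ∈ (Finset.range (a + b + 1)).erase b,
      (∏ l ∈ Finset.range (b - a), ((y : ℂ) - ((a + l : ℕ) : ℂ))) • E y ∈ V := by
    intro y hy
    rw [Finset.mem_erase, Finset.mem_range] at hy
    by_cases h : y < a ∨ b < y
    · refine V.smul_mem _ (Submodule.sum_mem _ fun π _ => hsmul _ _ (hmem _ _ _ ?_ h))
      omega
    · rw [Finset.prod_eq_zero (i := y - a), zero_smul]
      · exact V.zero_mem
      · rw [Finset.mem_range]
        omega
      · rw [sub_eq_zero]
        congr 1
        omega
  have hEb : E b ∈ V := by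
    rw [← Finset.add_sum_erase _ _ (Finset.mem_range.2 (show b < a + b + 1 by omega))] at hrel
    have h1 := V.neg_mem (Submodule.sum_mem V hE)
    rw [← eq_neg_of_add_eq_zero_left hrel] at h1
    refine (V.smul_mem_iff (Finset.prod_ne_zero_iff.2 fun l hl => ?_)).1 h1
    rw [Finset.mem_range] at hl
    rw [sub_ne_zero]
    exact_mod_cast (show b ≠ a + l by omega)
  let S := Finset.univ.filter fun π : Equiv.Perm ({m // P m} ⊕ {m // Q m}) =>
    Set.MapsTo π (Set.range Sum.inl) (Set.range Sum.inl)
  have hsplit : E b = (S.card : ℂ) • (plueckerD I a * plueckerD J b) +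
      ∑ π ∈ Finset.univ.filter fun π : Equiv.Perm ({m // P m} ⊕ {m // Q m}) =>
          ¬ Set.MapsTo π (Set.range Sum.inl) (Set.range Sum.inl),
        ((Equiv.Perm.sign π : ℤ) : MvPolynomial (ZVar n p) ℂ) *
          (plueckerD (exchangeLeft I J π) a * plueckerD (exchangeRight I J π) b) := by
    simp only [E, Nat.add_sub_cancel]
    rw [← Finset.sum_filter_add_sum_filter_not Finset.univ
      (fun π : Equiv.Perm ({m // P m} ⊕ {m // Q m}) =>
        Set.MapsTo π (Set.range Sum.inl) (Set.range Sum.inl))]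
    congr 1
    rw [Nat.cast_smul_eq_nsmul, ← Finset.sum_const]
    refine Finset.sum_congr rfl fun π hπ => ?_
    exact sign_mul_exchange_of_mapsTo I J a b π (Finset.mem_filter.1 hπ).2
  have hS : (S.card : ℂ) ≠ 0 := by
    rw [Nat.cast_ne_zero, Finset.card_ne_zero]
    exact ⟨1, Finset.mem_filter.2 ⟨Finset.mem_univ _, fun x hx => hx⟩⟩
  refine (V.smul_mem_iff hS).1 ?_
  rw [eq_sub_of_add_eq hsplit.symm]
  refine V.sub_mem hEb (Submodule.sum_mem _ fun π hπ => hsmul _ _ (hmem' π ?_))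
  exact (Finset.mem_filter.1 hπ).2

/-! ### Order ideals of the poset and chains of ideals -/

section Ideals

variable {n p : ℕ}

theorem mem_phi {I : Fin p → Fin n} {k : ℕ} {q : TildeQ n p} :
    q ∈ phi I k ↔ q.i ≤ k ∨ ∃ m : Fin p, q.i + m = k + p ∧ q.j ≤ q.i + I m := by
  rw [phi, Set.Finite.mem_toFinset]
  rfl

theorem add_sub_le_of_strictMono {I : Fin p → Fin n} (hI : StrictMono I) {a b : Fin p}
    (hab : a ≤ b) : (I a : ℕ) + (b - a) ≤ I b := by
  obtain ⟨b, hb⟩ := b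
  induction b with
  | zero =>
    have : a = ⟨0, hb⟩ := le_antisymm hab (Fin.le_def.2 (Nat.zero_le _))
    subst this
    simp
  | succ b ih =>
    rcases hab.eq_or_lt with rfl | h
    · simp
    · have h1 : (⟨b, by omega⟩ : Fin p) < ⟨b + 1, hb⟩ := Fin.lt_def.2 (Nat.lt_succ_self b)
      have h2 := ih (by omega) (by rw [Fin.lt_def] at h; exact Fin.le_def.2 (Nat.le_of_lt_succ h))
      have h3 := hI h1
      rw [Fin.lt_def] at h h3
      simp only at h h2 ⊢
      omega

theorem le_of_strictMono {I : Fin p → Fin n} (hI : StrictMono I) (m : Fin p) : (m : ℕ) ≤ I m := by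
  have h := add_sub_le_of_strictMono hI (a := ⟨0, by have := m.2; omega⟩) (b := m)
    (Fin.le_def.2 (Nat.zero_le _))
  simp only at h
  omega

theorem add_lt_of_strictMono {I : Fin p → Fin n} (hI : StrictMono I) (m : Fin p) :
    (I m : ℕ) + p ≤ m + n := by
  have hm := m.2
  have h := add_sub_le_of_strictMono hI (a := m) (b := ⟨p - 1, by omega⟩)
    (Fin.le_def.2 (by simp only; omega))
  have := (I ⟨p - 1, by omega⟩).2
  simp only at h
  omega

/-- In a row `i` with `k < i ≤ k + p` the bound on `j` comes from position `k + p - i`. Going down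
by the first clause of the order uses that `I` grows by at least one per position, and by the third
that `m ≤ I m ≤ m + n - p`; the second leads to rows `≤ k`. -/
theorem isLowerSet_phi {I : Fin p → Fin n} (hI : StrictMono I) (k : ℕ) (hpn : p < n) :
    IsLowerSet (phi I k : Set (TildeQ n p)) := by
  intro q q' hle hq
  rw [Finset.mem_coe, mem_phi] at hq ⊢
  rw [TildeQ.le_def] at hle
  obtain ⟨i, j, h₁, h₂, h₃, h₄⟩ := q
  obtain ⟨i', j', h₁', h₂', h₃', h₄'⟩ := q'
  simp only at hq hle ⊢
  by_cases hk : i' ≤ k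
  · exact Or.inl hk
  right
  have hlow : i' ≤ k + p := by
    rcases hq with hq | ⟨m, hm, hq⟩
    · omega
    · have := add_lt_of_strictMono hI m
      omega
  have hp : 0 < p := by omega
  let m' : Fin p := ⟨k + p - i', by omega⟩
  have hm' : (m' : ℕ) = k + p - i' := rfl
  refine ⟨m', by omega, ?_⟩
  have hmI := le_of_strictMono hI m'
  rcases hq with hq | ⟨m, hm, hq⟩
  · omega
  · have := add_lt_of_strictMono hI m
    rcases hle with hle | hle | hle
    · have := add_sub_le_of_strictMono hI (a := m) (b := m') (Fin.le_def.2 (by omega))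
      omega
    · omega
    · omega

/-- The diagonal elements `q_{i,i}`, `i > p`, form a chain; `k` is the number of them in `F`. The
tuple is read off from where the rows `k + 1, …, k + p` of `F` end. -/
theorem exists_phi_eq (hp : 1 ≤ p) (hpn : p < n) (F : Finset (TildeQ n p))
    (hF : IsLowerSet (F : Set (TildeQ n p))) :
    ∃ I : Fin p → Fin n, StrictMono I ∧ ∃ k, phi I k = F := by
  classical
  -- The quantifier over `q` makes the first condition vacuous for `k = 0`, since `j ≥ p + 1`.
  obtain ⟨k, hk0, hk⟩ : ∃ k, (∀ q : TildeQ n p, q.i = k + p → q.j = k + p → q ∈ F) ∧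
      ∀ q : TildeQ n p, q.i = k + p + 1 → q.j = k + p + 1 → q ∉ F := by
    let C : ℕ → Prop := fun k => ∃ q : TildeQ n p, q.i = k + p + 1 ∧ q.j = k + p + 1 ∧ q ∉ F
    have hC : ∃ k, C k := by
      by_contra hC
      simp only [not_exists] at hC
      let g : ℕ → TildeQ n p := fun k => ⟨k + p + 1, k + p + 1, by omega, by omega, le_rfl, by omega⟩
      have hg : Function.Injective g := fun a b h => by
        have := congrArg TildeQ.i h
        simp only [g] at this
        omega
      refine Set.infinite_of_injective_forall_mem hg (fun k => ?_) F.finite_toSet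
      by_contra hk
      exact hC k ⟨g k, rfl, rfl, hk⟩
    refine ⟨Nat.find hC, fun q hi hj => ?_, fun q hi hj hq => ?_⟩
    · by_contra hq
      rcases Nat.eq_zero_or_pos (Nat.find hC) with h | h
      · have := q.lt_j
        omega
      · exact Nat.find_min hC (m := Nat.find hC - 1) (by omega)
          ⟨q, by omega, by omega, hq⟩
    · obtain ⟨q', hi', hj', hq'⟩ := Nat.find_spec hC
      have : q = q' := TildeQ.ext (hi.trans hi'.symm) (hj.trans hj'.symm)
      exact hq' (this ▸ hq)
  -- Row `i` reaches offset `c`; places with `j ≤ p`, which are missing from `Q̃`, count as filled.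
  let B : ℕ → ℕ → Prop := fun i c => i + c ≤ p ∨ ∃ q ∈ F, q.i = i ∧ q.j = i + c
  have hBlt : ∀ i c, 1 ≤ i → B i c → c < n := by
    rintro i c hi (h | ⟨q, -, hqi, hqj⟩)
    · omega
    · have := q.lt
      omega
  have hB0 : ∀ i, k + 1 ≤ i → i ≤ k + p → B i 0 := by
    intro i h1 h2
    by_cases hip : i ≤ p
    · exact Or.inl hip
    · right
      refine ⟨⟨i, i, by omega, by omega, le_rfl, by omega⟩, ?_, rfl, rfl⟩
      have h3 := hk0 ⟨k + p, k + p, by omega, by omega, le_rfl, by omega⟩ rfl rfl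
      exact hF (show (⟨i, i, _, _, _, _⟩ : TildeQ n p) ≤ ⟨k + p, k + p, _, _, _, _⟩ from
        Or.inl ⟨h2, h2⟩) h3
  have hBmono : ∀ i c c', c' ≤ c → 1 ≤ i → B i c → B i c' := by
    rintro i c c' hc hi (h | ⟨q, hq, hqi, hqj⟩)
    · left
      omega
    · by_cases hip : i + c' ≤ p
      · exact Or.inl hip
      · right
        have := q.lt
        refine ⟨⟨i, i + c', hi, by omega, by omega, by omega⟩, ?_, rfl, rfl⟩
        exact hF (show (⟨i, i + c', _, _, _, _⟩ : TildeQ n p) ≤ q from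
          Or.inl ⟨hqi.ge, by simp only; omega⟩) hq
  let b : ℕ → ℕ := fun i => Nat.findGreatest (B i) (n - 1)
  have hb : ∀ i, k + 1 ≤ i → i ≤ k + p → B i (b i) := fun i h1 h2 =>
    Nat.findGreatest_spec (m := 0) (Nat.zero_le _) (hB0 i h1 h2)
  have hble : ∀ i c, 1 ≤ i → B i c → c ≤ b i := fun i c hi hc =>
    Nat.le_findGreatest (by have := hBlt i c hi hc; omega) hc
  let I : Fin p → Fin n := fun m => ⟨b (k + p - m), by
    have := Nat.findGreatest_le (P := B (k + p - m)) (n - 1)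
    simp only [b]
    omega⟩
  have hbstep : ∀ i, k + 1 ≤ i → i + 1 ≤ k + p → b (i + 1) < b i := by
    intro i h1 h2
    have h3 := hb (i + 1) (by omega) h2
    have hlt := hBlt _ _ (by omega) h3
    refine hble i _ (by omega) ?_
    rcases h3 with h3 | ⟨q, hq, hqi, hqj⟩
    · left
      omega
    · by_cases hbn : b (i + 1) + 1 < n
      · by_cases hip : i + (b (i + 1) + 1) ≤ p
        · exact Or.inl hip
        · right
          refine ⟨⟨i, i + (b (i + 1) + 1), by omega, by omega, by omega, by omega⟩, ?_, rfl, rfl⟩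
          exact hF (show (⟨i, i + (b (i + 1) + 1), _, _, _, _⟩ : TildeQ n p) ≤ q from
            Or.inl ⟨by simp only; omega, by simp only; omega⟩) hq
      -- Here row `i + 1` is full, and by the third clause of the order its last element lies above
      -- the diagonal element excluded from `F`.
      · exfalso
        refine hk ⟨k + p + 1, k + p + 1, by omega, by omega, le_rfl, by omega⟩ rfl rfl ?_
        exact hF (show (⟨k + p + 1, k + p + 1, _, _, _, _⟩ : TildeQ n p) ≤ q from
            Or.inr (Or.inr (by simp only; omega))) hq
  have hbanti : ∀ d i, k + 1 ≤ i → i + (d + 1) ≤ k + p → b (i + (d + 1)) < b i := by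
    intro d
    induction d with
    | zero => exact hbstep
    | succ d ih =>
      intro i h1 h2
      exact (hbstep (i + (d + 1)) (by omega) h2).trans (ih i h1 (by omega))
  refine ⟨I, fun m m' hmm' => ?_, k, ?_⟩
  · rw [Fin.lt_def] at hmm' ⊢
    have h1 := hbanti ((m' : ℕ) - m - 1) (k + p - m') (by omega) (by omega)
    have h2 : k + p - (m' : ℕ) + ((m' : ℕ) - m - 1 + 1) = k + p - m := by omega
    rw [h2] at h1
    exact h1
  · ext q
    rw [mem_phi]
    constructor
    · rintro (hq | ⟨m, hm, hq⟩)
      · have h1 := q.one_le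
        have h3 := hk0 ⟨k + p, k + p, by omega, by omega, le_rfl, by omega⟩ rfl rfl
        exact hF (show q ≤ ⟨k + p, k + p, _, _, _, _⟩ from
          Or.inr (Or.inl (by simp only; omega))) h3
      · have h1 := q.one_le
        have h2 := q.le
        have h3 := q.lt_j
        have hqi : q.i = k + p - m := by omega
        have h4 : B q.i (q.j - q.i) := by
          refine hBmono _ _ _ ?_ h1 (hb q.i (by omega) (by omega))
          have : ((I m : ℕ)) = b q.i := by rw [hqi]
          omega
        rcases h4 with h4 | ⟨q', hq', hi', hj'⟩
        · omega
        · have : q = q' := TildeQ.ext hi'.symm (by omega)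
          exact this ▸ hq'
    · intro hq
      by_cases hqk : q.i ≤ k
      · exact Or.inl hqk
      right
      have h1 := q.one_le
      have h2 := q.le
      by_cases hqp : q.i ≤ k + p
      · refine ⟨⟨k + p - q.i, by omega⟩, by simp only; omega, ?_⟩
        have h3 : q.j - q.i ≤ b q.i := hble _ _ h1 (Or.inr ⟨q, hq, rfl, by omega⟩)
        have h4 : ((I ⟨k + p - q.i, by omega⟩ : Fin n) : ℕ) = b q.i := by
          have h5 : k + p - (k + p - q.i) = q.i := by omega
          simp only [I, h5]
        omega
      · exfalso
        refine hk ⟨k + p + 1, k + p + 1, by omega, by omega, le_rfl, by omega⟩ rfl rfl ?_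
        exact hF (show (⟨k + p + 1, k + p + 1, _, _, _, _⟩ : TildeQ n p) ≤ q from
            Or.inl ⟨by simp only; omega, by simp only; omega⟩) hq

/-- The row bounded by position `m` of `I` is bounded by position `m + (b - a)` of `J`, or lies
entirely in the second ideal. -/
theorem phi_subset_phi {I J : Fin p → Fin n} {a b : ℕ} (hab : a ≤ b)
    (h : ∀ i j : Fin p, (i : ℕ) + (b - a) = j → I i ≤ J j) : phi I a ⊆ phi J b := by
  intro q hq
  rw [mem_phi] at hq ⊢
  rcases hq with hq | ⟨m, hm, hq⟩
  · left
    omega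
  · by_cases hqb : q.i ≤ b
    · exact Or.inl hqb
    · right
      refine ⟨⟨m + (b - a), by omega⟩, by simp only; omega, ?_⟩
      have := h m ⟨m + (b - a), by omega⟩ rfl
      rw [Fin.le_def] at this
      omega

theorem phi_subset_right_le {I J : Fin p → Fin n} {a b : ℕ} (hp : 1 ≤ p) (hpn : p < n)
    (h : phi I a ⊆ phi J b) : a ≤ b := by
  by_contra hab
  have h1 : (⟨a + p, a + p, by omega, by omega, le_rfl, by omega⟩ : TildeQ n p) ∈ phi I a := by
    rw [mem_phi]
    right
    exact ⟨⟨0, hp⟩, rfl, Nat.le_add_right _ _⟩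
  have h2 := h h1
  rw [mem_phi] at h2
  rcases h2 with h2 | ⟨m, hm, -⟩
  · simp only at h2
    omega
  · simp only at hm
    omega

theorem le_of_phi_subset {I J : Fin p → Fin n} {a : ℕ}
    (hJ : StrictMono J) (h : phi I a ⊆ phi J a) (m : Fin p) : I m ≤ J m := by
  have hm := m.2
  by_contra hcon
  rw [Fin.le_def, not_le] at hcon
  have h1 := le_of_strictMono hJ m
  have h2 := (I m).2
  have h3 : (⟨a + p - m, a + p - m + I m, by omega, by omega, by omega, by omega⟩ : TildeQ n p) ∈
      phi I a := by
    rw [mem_phi]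
    right
    exact ⟨m, by simp only; omega, le_rfl⟩
  have h4 := h h3
  rw [mem_phi] at h4
  rcases h4 with h4 | ⟨m', hm', h4⟩
  · simp only at h4
    omega
  · simp only at hm' h4
    have : m' = m := Fin.ext (by omega)
    subst this
    omega

variable (n p) in
/-- The indices of the generators `D_I^{(k)}` with increasing `I`. -/
abbrev Gen : Type := {I : Fin p → Fin n // StrictMono I} × ℕ

/-- The order ideal of a generator. -/
def Gen.ideal (x : Gen n p) : Finset (TildeQ n p) := phi x.1.1 x.2

theorem Gen.ideal_injective (hp : 1 ≤ p) (hpn : p < n) :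
    Function.Injective (Gen.ideal : Gen n p → _) := by
  rintro ⟨⟨I, hI⟩, a⟩ ⟨⟨J, hJ⟩, b⟩ h
  have h' : phi I a = phi J b := h
  have hab : a = b := le_antisymm (phi_subset_right_le hp hpn h'.subset)
    (phi_subset_right_le hp hpn h'.symm.subset)
  subst hab
  have : I = J := by
    funext m
    exact le_antisymm (le_of_phi_subset hJ h'.subset m)
      (le_of_phi_subset hI h'.symm.subset m)
  subst this
  rfl

theorem idealPoint_univ_apply (F : Finset (TildeQ n p)) (q : TildeQ n p) [Decidable (q ∈ F)] :
    idealPoint Set.univ ∅ F q = if q ∈ F then 1 else 0 := by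
  classical
  simp [idealPoint, Finsupp.onFinset_apply]

/-- A multiset of generators whose ideals form a chain. -/
def Standard (s : Multiset (Gen n p)) : Prop :=
  ∀ x ∈ s, ∀ y ∈ s, x.ideal ⊆ y.ideal ∨ y.ideal ⊆ x.ideal

theorem Standard.exists_ideal_eq_support {s : Multiset (Gen n p)} (hs : Standard s)
    (hs0 : s ≠ 0) : ∃ x ∈ s,
      x.ideal = (s.map fun x => idealPoint Set.univ ∅ x.ideal).sum.support := by
  classical
  obtain ⟨x, hx, hmax⟩ := Finset.exists_max_image s.toFinset (fun x => x.ideal.card)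
    (by rwa [Multiset.toFinset_nonempty])
  rw [Multiset.mem_toFinset] at hx
  have hsub : ∀ y ∈ s, y.ideal ⊆ x.ideal := by
    intro y hy
    rcases hs x hx y hy with h | h
    · exact (Finset.eq_of_subset_of_card_le h (hmax y (Multiset.mem_toFinset.2 hy))).symm.subset
    · exact h
  refine ⟨x, hx, ?_⟩
  ext q
  rw [Finsupp.mem_support_iff, ← Finsupp.applyAddHom_apply, map_multiset_sum, Multiset.map_map, ne_eq,
    Multiset.sum_eq_zero_iff]
  simp only [Multiset.mem_map, Function.comp_apply, Finsupp.applyAddHom_apply,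
    idealPoint_univ_apply, forall_exists_index, and_imp, forall_apply_eq_imp_iff₂, not_forall]
  constructor
  · intro hq
    exact ⟨x, hx, by simp [hq]⟩
  · rintro ⟨y, hy, hq⟩
    refine hsub y hy ?_
    by_contra h
    exact hq (if_neg h)

/-- The support of the sum is the largest ideal of the chain, which can be split off. The lengths
must be compared separately because the empty ideal contributes the zero vector. -/
theorem Standard.eq_of_sum_eq (hp : 1 ≤ p) (hpn : p < n) {s t : Multiset (Gen n p)}
    (hs : Standard s) (ht : Standard t) (hcard : s.card = t.card)
    (h : (s.map fun x => idealPoint Set.univ ∅ x.ideal).sum =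
      (t.map fun x => idealPoint Set.univ ∅ x.ideal).sum) : s = t := by
  classical
  induction hd : s.card generalizing s t with
  | zero =>
    rw [Multiset.card_eq_zero.1 hd, eq_comm, ← Multiset.card_eq_zero, ← hcard, hd]
  | succ d ih =>
    obtain ⟨x, hx, hx'⟩ := hs.exists_ideal_eq_support (by rintro rfl; simp at hd)
    obtain ⟨y, hy, hy'⟩ := ht.exists_ideal_eq_support (by rintro rfl; rw [hd] at hcard; simp at hcard)
    have hxy : x = y := Gen.ideal_injective hp hpn (by rw [hx', hy', h])
    subst hxy
    obtain ⟨s, rfl⟩ := Multiset.exists_cons_of_mem hx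
    obtain ⟨t, rfl⟩ := Multiset.exists_cons_of_mem hy
    simp only [Multiset.map_cons, Multiset.sum_cons, Multiset.card_cons, add_left_inj,
      add_right_inj] at h hcard hd
    rw [ih (fun a ha b hb => hs a (Multiset.mem_cons_of_mem ha) b (Multiset.mem_cons_of_mem hb))
      (fun a ha b hb => ht a (Multiset.mem_cons_of_mem ha) b (Multiset.mem_cons_of_mem hb))
      hcard h hd]

end Ideals

/-! ### Spanning by standard products -/

section Spanning

variable {n p : ℕ}

/-- The product of the `D_I^{(k)}` over a multiset of indices. -/
def plueckerProd (s : Multiset ((Fin p → Fin n) × ℕ)) : MvPolynomial (ZVar n p) ℂ :=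
  (s.map fun x => plueckerD x.1 x.2).prod

/-- The underlying pair of a tuple and a degree. -/
def Gen.toPair (x : Gen n p) : (Fin p → Fin n) × ℕ := (x.1.1, x.2)

/-- The span of the standard monomials. -/
def standardSpan (n p : ℕ) : Submodule ℂ (MvPolynomial (ZVar n p) ℂ) :=
  Submodule.span ℂ (Set.range fun t : {t : Multiset (Gen n p) // Standard t} =>
    plueckerProd (t.1.map Gen.toPair))

theorem exists_gen_of_injective (I : Fin p → Fin n) (hI : Function.Injective I) (k : ℕ) :
    ∃ (x : Gen n p) (c : ℂ), plueckerD I k = c • plueckerD x.1.1 x.2 ∧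
      weight x.1.1 x.2 = weight I k := by
  have h1 : StrictMono (I ∘ Tuple.sort I) :=
    (Tuple.monotone_sort I).strictMono_of_injective (hI.comp (Tuple.sort I).injective)
  refine ⟨(⟨_, h1⟩, k), ((Equiv.Perm.sign (Tuple.sort I) : ℤ) : ℂ), ?_, ?_⟩
  · rw [plueckerD_comp_perm]
    rcases Int.units_eq_one_or (Equiv.Perm.sign (Tuple.sort I)) with h | h <;> simp [h]
  · simp only [weight, Function.comp_apply]
    congr 1
    exact Equiv.sum_comp (Tuple.sort I) fun m => (I m : ℕ)

theorem exists_multiset_gen (s : Multiset ((Fin p → Fin n) × ℕ))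
    (hs : ∀ x ∈ s, Function.Injective x.1) : ∃ (t : Multiset (Gen n p)) (c : ℂ),
      plueckerProd s = c • plueckerProd (t.map Gen.toPair) ∧
      t.map (fun x => weight x.1.1 x.2) = s.map fun x => weight x.1 x.2 := by
  induction s using Multiset.induction_on with
  | empty => exact ⟨0, 1, by simp [plueckerProd]⟩
  | cons y s ih =>
    obtain ⟨t, c, h1, h2⟩ := ih fun x hx => hs x (Multiset.mem_cons_of_mem hx)
    obtain ⟨x, c', h3, h4⟩ := exists_gen_of_injective y.1 (hs y (Multiset.mem_cons_self _ _)) y.2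
    refine ⟨x ::ₘ t, c' * c, ?_, ?_⟩
    · rw [plueckerProd] at h1 ⊢
      rw [Multiset.map_cons, Multiset.prod_cons, h1, h3, smul_mul_smul_comm]
      simp [plueckerProd, Gen.toPair]
    · rw [Multiset.map_cons, Multiset.map_cons, h2, h4]

theorem exists_violation {x y : Gen n p} (hxy : x.2 ≤ y.2) (h : ¬ x.ideal ⊆ y.ideal) :
    ∃ i j : Fin p, (i : ℕ) + (y.2 - x.2) = j ∧ y.1.1 j < x.1.1 i := by
  by_contra hcon
  refine h (phi_subset_phi hxy fun i j hij => ?_)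
  by_contra hlt
  exact hcon ⟨i, j, hij, not_le.1 hlt⟩

/-- Of two incomparable ideals neither contains the other, so the pair can be put into the order
that straightening requires. -/
theorem Standard.exists_of_not {t : Multiset (Gen n p)} (ht : ¬ Standard t) :
    ∃ (x y : Gen n p) (u : Multiset (Gen n p)), t = x ::ₘ y ::ₘ u ∧ x.2 ≤ y.2 ∧
      (x.2 = y.2 → ∑ m, (x.1.1 m : ℕ) ≤ ∑ m, (y.1.1 m : ℕ)) ∧ ¬ x.ideal ⊆ y.ideal := by
  simp only [Standard, not_forall, not_or] at ht
  obtain ⟨x, hx, y, hy, h1, h2⟩ := ht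
  obtain ⟨t, rfl⟩ := Multiset.exists_cons_of_mem hx
  have hy' : y ∈ t := by
    rcases Multiset.mem_cons.1 hy with rfl | h
    · exact absurd (Finset.Subset.refl _) h1
    · exact h
  obtain ⟨u, rfl⟩ := Multiset.exists_cons_of_mem hy'
  by_cases h : x.2 < y.2 ∨ x.2 = y.2 ∧ ∑ m, (x.1.1 m : ℕ) ≤ ∑ m, (y.1.1 m : ℕ)
  · exact ⟨x, y, u, rfl, by omega, by omega, h1⟩
  · exact ⟨y, x, u, Multiset.cons_swap _ _ _, by omega, by omega, h2⟩

theorem sum_sq_le_sq_sum (s : Multiset ℕ) : (s.map fun w => w ^ 2).sum ≤ s.sum ^ 2 := by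
  induction s using Multiset.induction_on with
  | empty => simp
  | cons a s ih =>
    rw [Multiset.map_cons, Multiset.sum_cons, Multiset.sum_cons]
    nlinarith [Nat.zero_le (a * s.sum)]

/-- Straightening preserves the sum of the weights and increases the sum of their squares, which is
bounded by the square of the sum; this makes the induction terminate. -/
theorem plueckerProd_mem_standardSpan (s : Multiset ((Fin p → Fin n) × ℕ)) :
    plueckerProd s ∈ standardSpan n p := by
  induction hd : (s.map fun x => weight x.1 x.2).sum ^ 2 -
    ((s.map fun x => weight x.1 x.2).map fun w => w ^ 2).sum using Nat.strong_induction_on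
    generalizing s with
  | _ d ih =>
  by_cases hs : ∀ x ∈ s, Function.Injective x.1
  · obtain ⟨t, c, h1, h2⟩ := exists_multiset_gen s hs
    rw [h1]
    refine Submodule.smul_mem _ c ?_
    by_cases ht : Standard t
    · exact Submodule.subset_span ⟨⟨t, ht⟩, rfl⟩
    · obtain ⟨x, y, u, rfl, hxy, hxy', hsub⟩ := Standard.exists_of_not ht
      obtain ⟨i, j, hij, hlt⟩ := exists_violation hxy hsub
      -- This choice of `V` lets a pair be straightened in the presence of the other factors.
      let V := (standardSpan n p).comap (LinearMap.mulRight ℂ (plueckerProd (u.map Gen.toPair)))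
      have hmem := plueckerD_mul_plueckerD_mem x.1.2 y.1.2 hxy hxy' hij hlt V (by
        intro I' J' a' b' hw hw'
        have h3 := ih _ ?_ ((I', a') ::ₘ (J', b') ::ₘ u.map Gen.toPair) rfl
        · simpa [V, plueckerProd, mul_assoc] using h3
        · rw [← hd, ← h2]
          have h4 : ((((I', a') ::ₘ (J', b') ::ₘ u.map Gen.toPair).map
              fun x => weight x.1 x.2)).sum =
              ((x ::ₘ y ::ₘ u).map fun x => weight x.1.1 x.2).sum := by
            simp only [Multiset.map_cons, Multiset.sum_cons, Multiset.map_map, ← add_assoc, hw]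
            rfl
          have h5 : ((((x ::ₘ y ::ₘ u).map fun x => weight x.1.1 x.2)).map fun w => w ^ 2).sum <
              (((((I', a') ::ₘ (J', b') ::ₘ u.map Gen.toPair).map
                fun x => weight x.1 x.2)).map fun w => w ^ 2).sum := by
            simp only [Multiset.map_cons, Multiset.sum_cons, Multiset.map_map, ← add_assoc]
            exact Nat.add_lt_add_right hw' _
          have h6 := sum_sq_le_sq_sum (((I', a') ::ₘ (J', b') ::ₘ u.map Gen.toPair).map
            fun x => weight x.1 x.2)
          rw [h4] at h6 ⊢
          omega)
      simpa [V, plueckerProd, Gen.toPair, mul_assoc] using hmem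
  · simp only [not_forall] at hs
    obtain ⟨x, hx, hxI⟩ := hs
    have : plueckerProd s = 0 := by
      refine Multiset.prod_eq_zero (Multiset.mem_map.2 ⟨x, hx, ?_⟩)
      exact plueckerD_eq_zero _ _ hxI
    rw [this]
    exact Submodule.zero_mem _

theorem plueckerAlgebra_le_standardSpan :
    Subalgebra.toSubmodule (plueckerAlgebra n p) ≤ standardSpan n p := by
  rw [plueckerAlgebra, Algebra.adjoin_eq_span, Submodule.span_le]
  intro f hf
  have : ∃ s : Multiset ((Fin p → Fin n) × ℕ), f = plueckerProd s := by
    induction hf using Submonoid.closure_induction with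
    | mem f hf =>
      obtain ⟨I, k, rfl⟩ := hf
      exact ⟨{(I, k)}, by simp [plueckerProd]⟩
    | one => exact ⟨0, by simp [plueckerProd]⟩
    | mul f g _ _ hf hg =>
      obtain ⟨s, rfl⟩ := hf
      obtain ⟨t, rfl⟩ := hg
      exact ⟨s + t, by simp [plueckerProd]⟩
  obtain ⟨s, rfl⟩ := this
  exact plueckerProd_mem_standardSpan s

end Spanning

/-- Consecutive windows of length `p` have products with quotient `l (k + p) / l k`, which dictates
a recursion of step `p`; the first `p` values need only have product `ε 0`. -/
theorem exists_scaling {p : ℕ} (hp : 0 < p) (ε : ℕ → ℂ) (hε : ∀ k, ε k ≠ 0) :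
    ∃ l : ℕ → ℂ, (∀ r, l r ≠ 0) ∧ ∀ k, ∏ m : Fin p, l (k + m.rev) = ε k := by
  have hex : ∃ l : ℕ → ℂ, (∀ r, r < p → l r = if r = 0 then ε 0 else 1) ∧
      ∀ r, l (r + p) = l r * (ε (r + 1) / ε r) := by
    let l : ℕ → ℂ := fun r => (if r % p = 0 then ε 0 else 1) *
      ∏ j ∈ Finset.range (r / p), ε (r % p + j * p + 1) / ε (r % p + j * p)
    refine ⟨l, fun r hr => ?_, fun r => ?_⟩
    · simp [l, Nat.mod_eq_of_lt hr, Nat.div_eq_of_lt hr]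
    · simp only [l, Nat.add_mod_right, Nat.add_div_right r hp, Finset.prod_range_succ]
      rw [Nat.mod_add_div', mul_assoc]
  obtain ⟨l, h0, hstep⟩ := hex
  have hl : ∀ r, l r ≠ 0 := by
    intro r
    induction r using Nat.strong_induction_on with
    | _ r ih =>
    by_cases hr : r < p
    · rw [h0 r hr]
      split_ifs
      · exact hε 0
      · exact one_ne_zero
    · obtain ⟨r, rfl⟩ := Nat.exists_eq_add_of_le' (not_lt.1 hr)
      rw [hstep]
      exact mul_ne_zero (ih r (by omega)) (div_ne_zero (hε _) (hε _))
  refine ⟨l, hl, fun k => ?_⟩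
  have hrev : ∏ m : Fin p, l (k + m.rev) = ∏ m : Fin p, l (k + m) :=
    Equiv.prod_comp Fin.revPerm (fun m : Fin p => l (k + m))
  rw [hrev, Fin.prod_univ_eq_prod_range (fun i => l (k + i))]
  clear hrev
  induction k with
  | zero =>
    rw [Finset.prod_eq_single 0]
    · rw [h0 _ (by omega)]
      simp
    · intro i hi hi0
      rw [h0 _ (by simpa using hi), if_neg (by omega)]
    · simp [hp.ne']
  | succ k ih =>
    have h1 := Finset.prod_range_succ (fun i => l (k + i)) p
    rw [Finset.prod_range_succ', ih, hstep, add_zero] at h1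
    have h2 : ∏ i ∈ Finset.range p, l (k + 1 + i) = ∏ i ∈ Finset.range p, l (k + (i + 1)) :=
      Finset.prod_congr rfl fun i _ => by rw [add_assoc, add_comm 1 i]
    rw [h2]
    refine mul_right_cancel₀ (hl k) (h1.trans ?_)
    field_simp [hε k]

/-! ### The monomial map on exponents and its inverse -/

section Exponents

variable {n p : ℕ}

theorem finite_setOf_i_le (N : ℕ) : {q : TildeQ n p | q.i ≤ N}.Finite := by
  apply Set.Finite.of_finite_image (f := fun q : TildeQ n p => (q.i, q.j))
  · apply (Set.finite_Iic ((N, N + n) : ℕ × ℕ)).subset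
    rintro _ ⟨q, hq, rfl⟩
    have h := q.lt
    exact ⟨hq, by change q.j ≤ N + n; have : q.i ≤ N := hq; omega⟩
  · intro a _ b _ hab
    exact TildeQ.ext (congrArg Prod.fst hab) (congrArg Prod.snd hab)

/-- The elements of `Q̃` that the variable in row `r` and column `c` contributes to. -/
def varIdeal (n p r c : ℕ) : Finset (TildeQ n p) :=
  ((finite_setOf_i_le (r + 1)).subset (t := {q : TildeQ n p |
    q.i ≤ r + 1 ∧ ((q.i = r + 1 ∧ q.j ≤ q.i + c) ∨ (q.i ≤ r ∧ (q.i - 1) % p = r % p))})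
    fun _ h => h.1).toFinset

theorem mem_varIdeal {r c : ℕ} {q : TildeQ n p} : q ∈ varIdeal n p r c ↔
    (q.i = r + 1 ∧ q.j ≤ q.i + c) ∨ (q.i ≤ r ∧ (q.i - 1) % p = r % p) := by
  rw [varIdeal, Set.Finite.mem_toFinset, Set.mem_ofPred_eq]
  omega

/-- The row of a variable. -/
def varRow (v : ZVar n p) : ℕ := p * (ofLex v).1 + (ofLex (ofLex v).2).1

/-- The column of a variable. -/
def varCol (v : ZVar n p) : Fin n := (ofLex (ofLex v).2).2

/-- The degree in `s` of the image of a variable. -/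
def varDegree (v : ZVar n p) : ℕ := if varRow v % p = 0 then 1 else 0

/-- The exponent of the `y_q` in the image of a variable. -/
def varExp (v : ZVar n p) : TildeQ n p →₀ ℕ :=
  idealPoint Set.univ ∅ (varIdeal n p (varRow v) (varCol v))

variable (n p) in
/-- The degree in `s` of the image of a monomial. -/
def sDegree : (ZVar n p →₀ ℕ) →ₗ[ℕ] ℕ := Finsupp.linearCombination ℕ varDegree

variable (n p) in
/-- The exponent of the `y_q` in the image of a monomial. -/
def yExp : (ZVar n p →₀ ℕ) →ₗ[ℕ] (TildeQ n p →₀ ℕ) := Finsupp.linearCombination ℕ varExp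

/-- The exponents `u` of the `y_q`, extended by the degree `d` in `s` to the pairs with
`j ≤ p`. -/
def extendedExp (d : ℕ) (u : TildeQ n p →₀ ℕ) (r c : ℕ) : ℤ :=
  if h : r + c < p then d else if h' : c < n then
    u ⟨r + 1, r + 1 + c, by omega, by omega, by omega, by omega⟩ else 0

/-- The exponent of the variable in row `r` and column `c` recovered from its image. -/
def recoveredExp (d : ℕ) (u : TildeQ n p →₀ ℕ) (r c : ℕ) : ℤ :=
  extendedExp d u r c - if c + 1 < n then extendedExp d u r (c + 1) else extendedExp d u (r + p) 0

theorem extendedExp_add (d d' : ℕ) (u u' : TildeQ n p →₀ ℕ) (r c : ℕ) :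
    extendedExp (d + d') (u + u') r c = extendedExp d u r c + extendedExp d' u' r c := by
  simp only [extendedExp]
  split_ifs <;> simp

theorem recoveredExp_add (d d' : ℕ) (u u' : TildeQ n p →₀ ℕ) (r c : ℕ) :
    recoveredExp (d + d') (u + u') r c = recoveredExp d u r c + recoveredExp d' u' r c := by
  simp only [recoveredExp, extendedExp_add]
  split_ifs <;> ring

open Classical in
theorem extendedExp_phi {I : Fin p → Fin n} (hI : StrictMono I) (k r c : ℕ) (hc : c < n) :
    extendedExp 1 (idealPoint Set.univ ∅ (phi I k)) r c =
      if r + 1 ≤ k ∨ ∃ m : Fin p, r + 1 + m = k + p ∧ c ≤ I m then 1 else 0 := by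
  rw [extendedExp]
  split_ifs with h1 h2 h2
  · rfl
  · exfalso
    refine h2 ?_
    by_cases hk : r + 1 ≤ k
    · exact Or.inl hk
    · by_cases hkp : r + 1 ≤ k + p
      · refine Or.inr ⟨⟨k + p - (r + 1), by omega⟩, by simp only; omega, ?_⟩
        have := le_of_strictMono hI ⟨k + p - (r + 1), by omega⟩
        simp only at this
        omega
      · omega
  · rw [idealPoint_univ_apply, if_pos]
    · rfl
    · rw [mem_phi]
      simpa using h2
  · rw [idealPoint_univ_apply, if_neg]
    · rfl
    · rw [mem_phi]
      simpa using h2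

variable [NeZero p]

theorem varRow_rowVar (r : ℕ) (c : Fin n) : varRow (rowVar r c : ZVar n p) = r :=
  Nat.div_add_mod r p

theorem varCol_rowVar (r : ℕ) (c : Fin n) : varCol (rowVar r c : ZVar n p) = c := rfl

/-- Exactly one of `p` consecutive row numbers is divisible by `p`. -/
theorem sDegree_initExp (I : Fin p → Fin n) (k : ℕ) : sDegree n p (initExp I k) = 1 := by
  have hmod : ∀ m : Fin p, (k + (m.rev : ℕ)) % p = initPerm p k m := fun _ => rfl
  simp only [initExp, rowExp, map_sum, sDegree, Finsupp.linearCombination_single, one_smul,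
    varDegree, varRow_rowVar, hmod]
  rw [Finset.sum_eq_single ((initPerm p k).symm 0)]
  · simp
  · intro m _ hm
    rw [if_neg]
    intro h
    refine hm ?_
    rw [Equiv.eq_symm_apply]
    exact Fin.ext h
  · simp

/-- The rows `k, …, k + p - 1` have distinct residues modulo `p`, so their variables contribute
initial segments of different chains of `Q̃`. These are disjoint with union the ideal. -/
theorem yExp_initExp (I : Fin p → Fin n) (k : ℕ) :
    yExp n p (initExp I k) = idealPoint Set.univ ∅ (phi I k) := by
  classical
  have hmod : ∀ m : Fin p, (k + (m.rev : ℕ)) % p = initPerm p k m := fun _ => rfl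
  ext q
  simp only [initExp, rowExp, map_sum, yExp, Finsupp.linearCombination_single, one_smul,
    varExp, varRow_rowVar, varCol_rowVar, Finsupp.finsetSum_apply, idealPoint_univ_apply]
  have hq1 := q.one_le
  by_cases hk : q.i ≤ k
  · rw [if_pos (mem_phi.2 (Or.inl hk)),
      Finset.sum_eq_single ((initPerm p k).symm (Fin.ofNat p (q.i - 1)))]
    · rw [if_pos]
      rw [mem_varIdeal]
      right
      refine ⟨by omega, ?_⟩
      rw [hmod, Equiv.apply_symm_apply]
      rfl
    · intro m _ hm
      rw [if_neg]
      rw [mem_varIdeal]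
      rintro (⟨h, -⟩ | ⟨-, h⟩)
      · omega
      · refine hm ?_
        rw [Equiv.eq_symm_apply]
        exact Fin.ext h.symm
    · simp
  · by_cases hkp : q.i ≤ k + p
    · let m₀ : Fin p := ⟨k + p - q.i, by omega⟩
      have hm₀ : q.i = k + m₀.rev + 1 := by
        simp only [m₀, Fin.val_rev]
        omega
      have hm₀' : q.i + m₀ = k + p := by
        simp only [m₀]
        omega
      rw [Finset.sum_eq_single m₀]
      · refine if_congr ?_ rfl rfl
        rw [mem_varIdeal, mem_phi]
        constructor
        · rintro (⟨-, h⟩ | ⟨h, -⟩)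
          · exact Or.inr ⟨m₀, hm₀', h⟩
          · omega
        · rintro (h | ⟨m, hm, h⟩)
          · omega
          · have : m = m₀ := Fin.ext (by omega)
            subst this
            exact Or.inl ⟨hm₀, h⟩
      · intro m _ hm
        rw [if_neg]
        rw [mem_varIdeal]
        rintro (⟨h, -⟩ | ⟨-, h⟩)
        · refine hm (Fin.rev_injective (Fin.ext ?_))
          omega
        · refine hm ((initPerm p k).injective (Fin.ext ?_))
          rw [← hmod, ← hmod, ← h, hm₀, Nat.add_sub_cancel]
      · simp
    · rw [if_neg]
      · refine Finset.sum_eq_zero fun m _ => if_neg ?_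
        rw [mem_varIdeal]
        have := m.rev.2
        omega
      · rw [mem_phi]
        rintro (h | ⟨m, h, -⟩) <;> omega

/-- Along the chain of a residue modulo `p`, place `(r, c)` is followed by `(r, c + 1)`, and the end
of row `r` by the start of row `r + p`. The indicator of the ideal drops once on each chain, at the
variable of the initial term; the added places with `j ≤ p` ensure this even if the ideal misses the
chain. -/
theorem recoveredExp_phi {I : Fin p → Fin n} (hI : StrictMono I) (k r : ℕ)
    (c : Fin n) : recoveredExp 1 (idealPoint Set.univ ∅ (phi I k)) r c =
      (initExp I k (rowVar r c) : ℤ) := by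
  classical
  have h1 : (initExp I k (rowVar r c) : ℤ) =
      if ∃ m : Fin p, r + 1 + m = k + p ∧ I m = c then 1 else 0 := by
    have hne : initExp I k (rowVar r c) ≠ 0 ↔ ∃ m : Fin p, r + 1 + m = k + p ∧ I m = c := by
      rw [initExp, rowExp_ne_zero]
      refine exists_congr fun m => and_congr_left fun _ => ?_
      have := m.2
      rw [Fin.val_rev]
      omega
    have hle : initExp I k (rowVar r c) ≤ 1 := rowExp_le_one hI.injective _
    split_ifs with h
    · have := hne.2 h
      omega
    · have : initExp I k (rowVar r c) = 0 := by
        by_contra h'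
        exact h (hne.1 h')
      omega
  have hc := c.2
  rw [h1, recoveredExp, extendedExp_phi hI k r c hc, extendedExp_phi hI k (r + p) 0 (by omega)]
  by_cases hk : r + 1 ≤ k
  · have e1 : r + p + 1 ≤ k ∨ ∃ m : Fin p, r + p + 1 + m = k + p ∧ 0 ≤ (I m : ℕ) := by
      by_cases h : r + p + 1 ≤ k
      · exact Or.inl h
      · exact Or.inr ⟨⟨k - (r + 1), by omega⟩, by simp only; omega, Nat.zero_le _⟩
    have e2 : ¬ ∃ m : Fin p, r + 1 + m = k + p ∧ I m = c := by
      rintro ⟨m, h, -⟩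
      omega
    rw [if_neg e2, if_pos (Or.inl hk), if_pos e1]
    split_ifs with h
    · rw [extendedExp_phi hI k r _ h, if_pos (Or.inl hk), sub_self]
    · rfl
  · have e1 : ¬ (r + p + 1 ≤ k ∨ ∃ m : Fin p, r + p + 1 + m = k + p ∧ 0 ≤ (I m : ℕ)) := by
      rintro (h | ⟨m, h, -⟩) <;> omega
    rw [if_neg e1]
    by_cases hkp : r + 1 ≤ k + p
    · let m₀ : Fin p := ⟨k + p - (r + 1), by omega⟩
      have hm₀ : r + 1 + (m₀ : ℕ) = k + p := by
        simp only [m₀]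
        omega
      have e2 : ∀ c' : ℕ, (r + 1 ≤ k ∨ ∃ m : Fin p, r + 1 + m = k + p ∧ c' ≤ I m) ↔
          c' ≤ I m₀ := by
        intro c'
        constructor
        · rintro (h | ⟨m, hm, h⟩)
          · exact absurd h hk
          · have : m = m₀ := Fin.ext (by omega)
            exact this ▸ h
        · exact fun h => Or.inr ⟨m₀, hm₀, h⟩
      have e3 : (∃ m : Fin p, r + 1 + m = k + p ∧ I m = c) ↔ (I m₀ : ℕ) = c := by
        constructor
        · rintro ⟨m, hm, h⟩
          have : m = m₀ := Fin.ext (by omega)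
          rw [← this, h]
        · exact fun h => ⟨m₀, hm₀, Fin.ext h⟩
      have hlt := (I m₀).2
      simp only [e2, e3]
      by_cases h : (c : ℕ) + 1 < n
      · rw [if_pos h, extendedExp_phi hI k r _ h]
        simp only [e2]
        split_ifs <;> omega
      · rw [if_neg h]
        split_ifs <;> omega
    · have e2 : ∀ c' : ℕ, ¬ (r + 1 ≤ k ∨ ∃ m : Fin p, r + 1 + m = k + p ∧ c' ≤ I m) := by
        rintro c' (h | ⟨m, h, -⟩) <;> omega
      have e3 : ¬ ∃ m : Fin p, r + 1 + m = k + p ∧ I m = c := by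
        rintro ⟨m, h, -⟩
        omega
      rw [if_neg (e2 _), if_neg e3]
      split_ifs with h
      · rw [extendedExp_phi hI k r _ h, if_neg (e2 _), sub_zero]
      · rfl

variable (n p) in
/-- The monoid of exponents generated by those of the initial terms of the `D_I^{(k)}`. -/
def initMonoid : AddSubmonoid (ZVar n p →₀ ℕ) :=
  AddSubmonoid.closure (Set.range fun x : Gen n p => initExp x.1.1 x.2)

theorem degree_eq_mul_sDegree {e : ZVar n p →₀ ℕ} (he : e ∈ initMonoid n p) :
    e.degree = p * sDegree n p e := by
  induction he using AddSubmonoid.closure_induction with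
  | mem e he =>
    obtain ⟨x, rfl⟩ := he
    simp only
    rw [sDegree_initExp, mul_one, initExp, degree_rowExp]
  | zero => simp
  | add e e' _ _ h h' => rw [map_add, map_add, h, h', mul_add]

/-- Both sides are additive in `e`, so the generators suffice. -/
theorem recoveredExp_eq {e : ZVar n p →₀ ℕ} (he : e ∈ initMonoid n p) (r : ℕ)
    (c : Fin n) : recoveredExp (sDegree n p e) (yExp n p e) r c = (e (rowVar r c) : ℤ) := by
  induction he using AddSubmonoid.closure_induction with
  | mem e he =>
    obtain ⟨x, rfl⟩ := he
    simp only
    rw [sDegree_initExp, yExp_initExp, recoveredExp_phi x.1.2]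
  | zero => simp [recoveredExp, extendedExp]
  | add e e' _ _ h h' =>
    rw [map_add, map_add, recoveredExp_add, h, h', Finsupp.add_apply, Nat.cast_add]

theorem eq_of_sDegree_eq_of_yExp_eq {e e' : ZVar n p →₀ ℕ}
    (he : e ∈ initMonoid n p) (he' : e' ∈ initMonoid n p) (hs : sDegree n p e = sDegree n p e')
    (hy : yExp n p e = yExp n p e') : e = e' := by
  ext v
  obtain ⟨r, c, rfl⟩ := exists_rowVar v
  have h := recoveredExp_eq he r c
  rw [hs, hy, recoveredExp_eq he' r c] at h
  exact_mod_cast h.symm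

end Exponents

/-! ### Gradings of the two algebras -/

section Grading

/-- A subalgebra generated by elements of degree one is graded. -/
theorem nonempty_gradedAlgebra_comap {A : Type*} [CommRing A] [Algebra ℂ A] (𝓗 : ℕ → Submodule ℂ A)
    [SetLike.GradedMonoid 𝓗] (hind : iSupIndep 𝓗) (S : Subalgebra ℂ A) (G : Set A)
    (hS : S = Algebra.adjoin ℂ G) (hG : G ⊆ 𝓗 1) :
    Nonempty (GradedAlgebra fun d => (𝓗 d).comap S.val.toLinearMap) := by
  classical
  let 𝒮 : ℕ → Submodule ℂ S := fun d => (𝓗 d).comap S.val.toLinearMap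
  have hgm : SetLike.GradedMonoid 𝒮 :=
    { one_mem := SetLike.GradedOne.one_mem (A := 𝓗)
      mul_mem := fun i j x y hx hy => SetLike.GradedMul.mul_mem (A := 𝓗) hx hy }
  have hind' : iSupIndep 𝒮 := by
    intro d
    rw [Submodule.disjoint_def]
    intro x hx hx'
    have h1 : S.val.toLinearMap x ∈ (⨆ (j) (_ : j ≠ d), 𝒮 j).map S.val.toLinearMap :=
      Submodule.mem_map_of_mem hx'
    have h2 : (⨆ (j) (_ : j ≠ d), 𝒮 j).map S.val.toLinearMap ≤ ⨆ (j) (_ : j ≠ d), 𝓗 j := by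
      simp only [Submodule.map_iSup]
      exact iSup₂_mono fun j _ => Submodule.map_comap_le _ _
    exact Subtype.ext ((Submodule.disjoint_def.1 (hind d)) _ hx (h2 h1))
  have htop : iSup 𝒮 = ⊤ := by
    rw [eq_top_iff]
    rintro ⟨x, hx⟩ -
    have hx' : x ∈ Algebra.adjoin ℂ G := hS ▸ hx
    have hmul : ∀ a b : S, a ∈ iSup 𝒮 → b ∈ iSup 𝒮 → a * b ∈ iSup 𝒮 := by
      intro a b ha hb
      induction ha using Submodule.iSup_induction' with
      | mem i a ha =>
        induction hb using Submodule.iSup_induction' with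
        | mem j b hb => exact Submodule.mem_iSup_of_mem (i + j) (hgm.mul_mem ha hb)
        | zero => simp
        | add b b' _ _ h h' =>
          rw [mul_add]
          exact Submodule.add_mem _ h h'
      | zero => simp
      | add a a' _ _ h h' =>
        rw [add_mul]
        exact Submodule.add_mem _ h h'
    have hone : (1 : S) ∈ iSup 𝒮 := Submodule.mem_iSup_of_mem 0 hgm.one_mem
    have key : ∃ h : x ∈ S, (⟨x, h⟩ : S) ∈ iSup 𝒮 := by
      induction hx' using Algebra.adjoin_induction with
      | mem x hxG => exact ⟨hS ▸ Algebra.subset_adjoin hxG, Submodule.mem_iSup_of_mem 1 (hG hxG)⟩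
      | algebraMap c =>
        refine ⟨S.algebraMap_mem c, ?_⟩
        have : (⟨algebraMap ℂ A c, S.algebraMap_mem c⟩ : S) = c • 1 :=
          Subtype.ext (Algebra.algebraMap_eq_smul_one c)
        rw [this]
        exact Submodule.smul_mem _ c hone
      | add a b ha hb h h' =>
        obtain ⟨h1, h2⟩ := h (hS ▸ ha)
        obtain ⟨h3, h4⟩ := h' (hS ▸ hb)
        exact ⟨S.add_mem h1 h3, Submodule.add_mem _ h2 h4⟩
      | mul a b ha hb h h' =>
        obtain ⟨h1, h2⟩ := h (hS ▸ ha)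
        obtain ⟨h3, h4⟩ := h' (hS ▸ hb)
        exact ⟨S.mul_mem h1 h3, hmul _ _ h2 h4⟩
    exact key.2
  have hint := DirectSum.isInternal_submodule_of_iSupIndep_of_iSup_eq_top hind' htop
  exact ⟨{ hgm with toDecomposition := hint.chooseDecomposition }⟩

variable (P : Type*)

/-- The elements of the form `c * s ^ d`. -/
def sGrade (d : ℕ) : Submodule ℂ (Polynomial (MvPolynomial P ℂ)) :=
  LinearMap.range ((Polynomial.monomial (R := MvPolynomial P ℂ) d).restrictScalars ℂ)

variable {P}

instance : SetLike.GradedMonoid (sGrade P) where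
  one_mem := ⟨1, rfl⟩
  mul_mem := by
    rintro i j _ _ ⟨a, rfl⟩ ⟨b, rfl⟩
    exact ⟨a * b, (Polynomial.monomial_mul_monomial i j a b).symm⟩

theorem iSupIndep_sGrade : iSupIndep (sGrade P) := by
  intro d
  rw [Submodule.disjoint_def]
  rintro _ ⟨c, rfl⟩ h
  have h1 : (⨆ (j) (_ : j ≠ d), sGrade P j) ≤
      LinearMap.ker ((Polynomial.lcoeff (MvPolynomial P ℂ) d).restrictScalars ℂ) := by
    refine iSup₂_le fun j hj => ?_
    rintro _ ⟨c, rfl⟩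
    simp [Polynomial.coeff_monomial, hj]
  have h2 := h1 h
  have h3 : c = 0 := by simpa using h2
  simp [h3]

end Grading

/-! ### Sagbi basis and isomorphism -/

section Isomorphism

variable {n p : ℕ}

/-- The term `a * s ^ d * y ^ u`. -/
def hibiTerm (d : ℕ) (u : TildeQ n p →₀ ℕ) (a : ℂ) : Polynomial (MvPolynomial (TildeQ n p) ℂ) :=
  Polynomial.monomial d (MvPolynomial.monomial u a)

theorem hibiTerm_mul (d d' : ℕ) (u u' : TildeQ n p →₀ ℕ) (a a' : ℂ) :
    hibiTerm d u a * hibiTerm d' u' a' = hibiTerm (d + d') (u + u') (a * a') := by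
  rw [hibiTerm, hibiTerm, Polynomial.monomial_mul_monomial, MvPolynomial.monomial_mul]
  rfl

theorem hibiTerm_one : (hibiTerm 0 0 1 : Polynomial (MvPolynomial (TildeQ n p) ℂ)) = 1 := rfl

theorem hibiTerm_prod {ι : Type*} (s : Finset ι) (d : ι → ℕ) (u : ι → TildeQ n p →₀ ℕ)
    (a : ι → ℂ) : ∏ i ∈ s, hibiTerm (d i) (u i) (a i) =
      hibiTerm (∑ i ∈ s, d i) (∑ i ∈ s, u i) (∏ i ∈ s, a i) := by
  classical
  induction s using Finset.induction_on with
  | empty => exact hibiTerm_one.symm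
  | insert i s hi ih =>
    rw [Finset.prod_insert hi, ih, hibiTerm_mul, Finset.sum_insert hi, Finset.sum_insert hi,
      Finset.prod_insert hi]

theorem hibiTerm_pow (d : ℕ) (u : TildeQ n p →₀ ℕ) (a : ℂ) (k : ℕ) :
    hibiTerm d u a ^ k = hibiTerm (k • d) (k • u) (a ^ k) := by
  have h := hibiTerm_prod (Finset.range k) (fun _ => d) (fun _ => u) (fun _ => a)
  simpa using h

theorem hibiTerm_eq_C_mul (u : TildeQ n p →₀ ℕ) (a : ℂ) :
    hibiTerm 1 u a = algebraMap ℂ _ a * sMonomial u := by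
  have : sMonomial u = hibiTerm 1 u 1 := by
    rw [sMonomial, hibiTerm, Polynomial.X_mul_C, Polynomial.C_mul_X_eq_monomial]
  rw [this, ← Algebra.smul_def, hibiTerm, hibiTerm, Polynomial.smul_monomial,
    MvPolynomial.smul_monomial, smul_eq_mul, mul_one]

/-- The homomorphism that sends the variable in row `r` to a term with coefficient `l r`. -/
def termHom (n p : ℕ) (l : ℕ → ℂ) :
    MvPolynomial (ZVar n p) ℂ →ₐ[ℂ] Polynomial (MvPolynomial (TildeQ n p) ℂ) :=
  MvPolynomial.aeval fun v => hibiTerm (varDegree v) (varExp v) (l (varRow v))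

theorem termHom_C_mul (l : ℕ → ℂ) (a : ℂ) (d : ℕ) (u : TildeQ n p →₀ ℕ) (b : ℂ) :
    termHom n p l (MvPolynomial.C a) * hibiTerm d u b = hibiTerm d u (a * b) := by
  have : termHom n p l (MvPolynomial.C a) = hibiTerm 0 0 a := by
    rw [termHom, MvPolynomial.aeval_C]
    rfl
  rw [this, hibiTerm_mul, zero_add, zero_add]

theorem exists_termHom_monomial (l : ℕ → ℂ) (hl : ∀ r, l r ≠ 0) (e : ZVar n p →₀ ℕ) :
    ∃ c : ℂ, c ≠ 0 ∧ ∀ a, termHom n p l (MvPolynomial.monomial e a) =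
      hibiTerm (sDegree n p e) (yExp n p e) (a * c) := by
  suffices h : ∃ c : ℂ, c ≠ 0 ∧ termHom n p l (MvPolynomial.monomial e 1) =
      hibiTerm (sDegree n p e) (yExp n p e) c by
    obtain ⟨c, hc, h⟩ := h
    refine ⟨c, hc, fun a => ?_⟩
    rw [← mul_one a, ← MvPolynomial.C_mul_monomial, map_mul, h, termHom_C_mul, mul_one]
  induction e using Finsupp.induction_linear with
  | zero =>
    refine ⟨1, one_ne_zero, ?_⟩
    rw [map_zero, map_zero, hibiTerm_one]
    exact map_one _
  | add e e' h h' =>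
    obtain ⟨c, hc, h⟩ := h
    obtain ⟨c', hc', h'⟩ := h'
    refine ⟨c * c', mul_ne_zero hc hc', ?_⟩
    rw [map_add, map_add, ← hibiTerm_mul, ← h, ← h', ← map_mul, MvPolynomial.monomial_mul, mul_one]
  | single v k =>
    refine ⟨l (varRow v) ^ k, pow_ne_zero _ (hl _), ?_⟩
    rw [← MvPolynomial.X_pow_eq_monomial, map_pow, termHom, MvPolynomial.aeval_X, hibiTerm_pow,
      sDegree, yExp, Finsupp.linearCombination_single, Finsupp.linearCombination_single]

variable [NeZero p]

theorem termHom_initExp (l : ℕ → ℂ) (I : Fin p → Fin n) (k : ℕ) (a : ℂ) :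
    termHom n p l (MvPolynomial.monomial (initExp I k) a) =
      hibiTerm 1 (idealPoint Set.univ ∅ (phi I k)) (a * ∏ m : Fin p, l (k + m.rev)) := by
  rw [← mul_one a, ← MvPolynomial.C_mul_monomial, map_mul, mul_one, ← termHom_C_mul l]
  congr 1
  rw [← sDegree_initExp I k, ← yExp_initExp I k]
  simp only [initExp, rowExp, MvPolynomial.monomial_sum_one, map_prod, map_sum]
  have h : ∀ m, termHom n p l (MvPolynomial.monomial
      (Finsupp.single (rowVar (k + (m.rev : ℕ)) (I m)) 1) 1) =
      hibiTerm (sDegree n p (Finsupp.single (rowVar (k + (m.rev : ℕ)) (I m)) 1))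
        (yExp n p (Finsupp.single (rowVar (k + (m.rev : ℕ)) (I m)) 1)) (l (k + m.rev)) := by
    intro m
    rw [sDegree, yExp, Finsupp.linearCombination_single, Finsupp.linearCombination_single,
      one_smul, one_smul]
    refine (MvPolynomial.aeval_X _ _).trans ?_
    rw [varRow_rowVar]
  rw [Finset.prod_congr rfl fun m _ => h m, hibiTerm_prod]

theorem isLeading_plueckerProd (t : Multiset (Gen n p)) :
    IsLeading (plueckerProd (t.map Gen.toPair)) (t.map fun x => initExp x.1.1 x.2).sum := by
  rw [plueckerProd, Multiset.map_map]
  exact IsLeading.multiset_prod (fun x : Gen n p => (isLeading_plueckerD x.1.2 x.2).1) t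

theorem sDegree_multiset_sum (t : Multiset (Gen n p)) :
    sDegree n p (t.map fun x => initExp x.1.1 x.2).sum = t.card := by
  rw [map_multiset_sum, Multiset.map_map]
  simp [sDegree_initExp]

theorem yExp_multiset_sum (t : Multiset (Gen n p)) :
    yExp n p (t.map fun x => initExp x.1.1 x.2).sum =
      (t.map fun x => idealPoint Set.univ ∅ x.ideal).sum := by
  rw [map_multiset_sum, Multiset.map_map]
  simp only [Function.comp_def, yExp_initExp, Gen.ideal]

/-- The degree in `s` of the image gives the length, and the `y`-exponents give the sum of the
indicator vectors. -/
theorem Standard.eq_of_sum_initExp_eq (hpn : p < n) {s t : Multiset (Gen n p)} (hs : Standard s)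
    (ht : Standard t) (h : (s.map fun x => initExp x.1.1 x.2).sum =
      (t.map fun x => initExp x.1.1 x.2).sum) : s = t := by
  refine hs.eq_of_sum_eq NeZero.one_le hpn ht ?_ ?_
  · rw [← sDegree_multiset_sum, ← sDegree_multiset_sum, h]
  · rw [← yExp_multiset_sum, ← yExp_multiset_sum, h]

theorem exists_isLeading_of_mem_plueckerAlgebra (hpn : p < n) {f : MvPolynomial (ZVar n p) ℂ}
    (hf : f ∈ plueckerAlgebra n p) (hf0 : f ≠ 0) :
    ∃ t : Multiset (Gen n p), IsLeading f (t.map fun x => initExp x.1.1 x.2).sum := by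
  have hspan : f ∈ standardSpan n p :=
    plueckerAlgebra_le_standardSpan ((Subalgebra.mem_toSubmodule _).2 hf)
  have hlead : ∀ t : {t : Multiset (Gen n p) // Standard t},
      IsLeading (plueckerProd (t.1.map Gen.toPair)) (t.1.map fun x => initExp x.1.1 x.2).sum :=
    fun t => isLeading_plueckerProd t.1
  have hinj : Function.Injective fun t : {t : Multiset (Gen n p) // Standard t} =>
      (t.1.map fun x => initExp x.1.1 x.2).sum :=
    fun s t h => Subtype.ext (s.2.eq_of_sum_initExp_eq hpn t.2 h)
  obtain ⟨t, ht⟩ := exists_isLeading_of_mem_span hlead hinj hspan hf0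
  exact ⟨t.1, ht⟩

/-- The `D_I^{(k)}` form a sagbi basis of the semi-infinite Plücker algebra. -/
theorem initialPluecker_eq_adjoin (hpn : p < n) : initialPluecker n p = Algebra.adjoin ℂ
    (Set.range fun x : Gen n p => MvPolynomial.monomial (initExp x.1.1 x.2) (1 : ℂ)) := by
  apply le_antisymm
  · refine Algebra.adjoin_le ?_
    rintro _ ⟨f, hf, rfl⟩
    by_cases hf0 : f = 0
    · have : initialTerm DegRevLexLT f = 0 := by simp [initialTerm, hf0]
      rw [this]
      exact Subalgebra.zero_mem _
    · obtain ⟨t, hlead⟩ := exists_isLeading_of_mem_plueckerAlgebra hpn hf hf0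
      rw [hlead.initialTerm_eq, ← mul_one (MvPolynomial.coeff _ f), ← smul_eq_mul,
        ← MvPolynomial.smul_monomial]
      refine Subalgebra.smul_mem _ ?_ _
      clear hlead
      induction t using Multiset.induction_on with
      | empty => exact Subalgebra.one_mem _
      | cons x t ih =>
        have h := Subalgebra.mul_mem _ (Algebra.subset_adjoin (R := ℂ) (Set.mem_range_self x)) ih
        rwa [MvPolynomial.monomial_mul, mul_one, ← Multiset.sum_cons,
          ← Multiset.map_cons (fun x : Gen n p => initExp x.1.1 x.2)] at h
  · refine Algebra.adjoin_le ?_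
    rintro _ ⟨x, rfl⟩
    have h := (initialD x.1.1 x.2).2
    rw [coe_initialD x.1.2] at h
    have h1 := Subalgebra.smul_mem _ h (initSign p x.2)⁻¹
    rw [MvPolynomial.smul_monomial, smul_eq_mul, inv_mul_cancel₀ (initSign_ne_zero _)] at h1
    exact h1

theorem mem_initMonoid_of_mem_support (hpn : p < n) {f : MvPolynomial (ZVar n p) ℂ}
    (hf : f ∈ initialPluecker n p) : ∀ e ∈ f.support, e ∈ initMonoid n p := by
  classical
  rw [initialPluecker_eq_adjoin hpn] at hf
  induction hf using Algebra.adjoin_induction with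
  | mem f hf =>
    obtain ⟨x, rfl⟩ := hf
    intro e he
    rw [Finset.mem_singleton.1 (MvPolynomial.support_monomial_subset he)]
    exact AddSubmonoid.subset_closure ⟨x, rfl⟩
  | algebraMap c =>
    intro e he
    rw [Finset.mem_singleton.1 (MvPolynomial.support_monomial_subset he)]
    exact AddSubmonoid.zero_mem _
  | add f g _ _ h h' =>
    intro e he
    rcases Finset.mem_union.1 (MvPolynomial.support_add he) with he | he
    · exact h e he
    · exact h' e he
  | mul f g _ _ h h' =>
    intro e he
    obtain ⟨a, ha, b, hb, rfl⟩ := Finset.mem_add.1 (MvPolynomial.support_mul f g he)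
    exact AddSubmonoid.add_mem _ (h a ha) (h' b hb)

/-- Distinct monomials of `f` go to multiples of distinct terms, so nothing cancels. Both
injectivity and the compatibility with the gradings rest on this. -/
theorem coeff_termHom_ne_zero (hpn : p < n) (l : ℕ → ℂ) (hl : ∀ r, l r ≠ 0)
    {f : MvPolynomial (ZVar n p) ℂ} (hf : f ∈ initialPluecker n p) {e : ZVar n p →₀ ℕ}
    (he : e ∈ f.support) :
    ((termHom n p l f).coeff (sDegree n p e)).coeff (yExp n p e) ≠ 0 := by
  classical
  have hsupp := mem_initMonoid_of_mem_support hpn hf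
  choose c hc hc' using exists_termHom_monomial (n := n) (p := p) l hl
  have h1 : ((termHom n p l f).coeff (sDegree n p e)).coeff (yExp n p e) = f.coeff e * c e := by
    conv_lhs => rw [f.as_sum]
    rw [map_sum, Polynomial.finsetSum_coeff, MvPolynomial.coeff_sum, Finset.sum_eq_single e]
    · rw [hc', hibiTerm, Polynomial.coeff_monomial, if_pos rfl, MvPolynomial.coeff_monomial,
        if_pos rfl]
    · intro e' he' hne
      rw [hc', hibiTerm, Polynomial.coeff_monomial]
      split_ifs with hs
      · rw [MvPolynomial.coeff_monomial, if_neg]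
        intro hy
        exact hne (eq_of_sDegree_eq_of_yExp_eq (hsupp e' he') (hsupp e he) hs hy)
      · simp
    · intro h
      exact absurd he h
  rw [h1]
  exact mul_ne_zero (MvPolynomial.mem_support_iff.1 he) (hc e)

theorem mem_sGrade_termHom_iff (hpn : p < n) (l : ℕ → ℂ) (hl : ∀ r, l r ≠ 0)
    {f : MvPolynomial (ZVar n p) ℂ} (hf : f ∈ initialPluecker n p) (d : ℕ) :
    f ∈ MvPolynomial.homogeneousSubmodule (ZVar n p) ℂ (p * d) ↔
      termHom n p l f ∈ sGrade (TildeQ n p) d := by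
  have hsupp := mem_initMonoid_of_mem_support hpn hf
  rw [MvPolynomial.mem_homogeneousSubmodule]
  constructor
  · intro h
    choose c hc hc' using exists_termHom_monomial (n := n) (p := p) l hl
    rw [f.as_sum, map_sum]
    refine Submodule.sum_mem _ fun e he => ?_
    have h1 : e.degree = p * d := by
      rw [Finsupp.degree_eq_weight_one]
      exact h (MvPolynomial.mem_support_iff.1 he)
    rw [degree_eq_mul_sDegree (hsupp e he), Nat.mul_right_inj (NeZero.ne p)] at h1
    rw [hc', hibiTerm, h1]
    exact ⟨_, rfl⟩
  · rintro ⟨g, hg⟩ e he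
    have he' := MvPolynomial.mem_support_iff.2 he
    have h1 := coeff_termHom_ne_zero hpn l hl hf he'
    rw [← hg] at h1
    have h2 : d = sDegree n p e := by
      by_contra hne
      refine h1 ?_
      rw [LinearMap.restrictScalars_apply, Polynomial.coeff_monomial, if_neg hne,
        MvPolynomial.coeff_zero]
    rw [h2, ← degree_eq_mul_sDegree (hsupp e he'), Finsupp.degree_eq_weight_one]
    rfl

theorem sMonomial_mem_hibiRing {P : Type*} [LE P] {O C : Set P} {F : Finset P}
    (hF : IsLowerSet (F : Set P)) : sMonomial (idealPoint O C F) ∈ hibiRing P O C :=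
  Algebra.subset_adjoin ⟨F, hF, rfl⟩

theorem termHom_mem_hibiRing (hpn : p < n) (l : ℕ → ℂ)
    {f : MvPolynomial (ZVar n p) ℂ} (hf : f ∈ initialPluecker n p) :
    termHom n p l f ∈ hibiRing (TildeQ n p) Set.univ ∅ := by
  have h : initialPluecker n p ≤
      (hibiRing (TildeQ n p) Set.univ ∅).comap (termHom n p l) := by
    rw [initialPluecker_eq_adjoin hpn]
    refine Algebra.adjoin_le ?_
    rintro _ ⟨x, rfl⟩
    change termHom n p l _ ∈ hibiRing (TildeQ n p) Set.univ ∅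
    rw [termHom_initExp, hibiTerm_eq_C_mul, ← Algebra.smul_def]
    exact Subalgebra.smul_mem _ (sMonomial_mem_hibiRing (isLowerSet_phi x.1.2 x.2 hpn)) _
  exact h hf

/-- The homomorphism from the initial subalgebra to the Hibi ring. -/
def initialToHibi (hpn : p < n) (l : ℕ → ℂ) :
    initialPluecker n p →ₐ[ℂ] hibiRing (TildeQ n p) Set.univ ∅ :=
  ((termHom n p l).comp (initialPluecker n p).val).codRestrict _
    fun f => termHom_mem_hibiRing hpn l f.2

theorem initialToHibi_bijective (hpn : p < n) (l : ℕ → ℂ) (hl : ∀ r, l r ≠ 0) :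
    Function.Bijective (initialToHibi (n := n) (p := p) hpn l) := by
  constructor
  · rw [injective_iff_map_eq_zero]
    intro f hf
    by_contra hf0
    have h1 : (f : MvPolynomial (ZVar n p) ℂ) ≠ 0 := fun h => hf0 (Subtype.ext h)
    obtain ⟨e, he⟩ := MvPolynomial.support_nonempty.2 h1
    refine coeff_termHom_ne_zero hpn l hl f.2 he ?_
    have h2 : termHom n p l f = 0 := congrArg Subtype.val hf
    rw [h2, Polynomial.coeff_zero, MvPolynomial.coeff_zero]
  · have h : hibiRing (TildeQ n p) Set.univ ∅ ≤
        ((hibiRing (TildeQ n p) Set.univ ∅).val.comp (initialToHibi hpn l)).range := by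
      refine Algebra.adjoin_le ?_
      rintro _ ⟨F, hF, rfl⟩
      -- Each generator of the Hibi ring belongs to some `I` and `k`, hence is the image of a
      -- multiple of an initial monomial.
      obtain ⟨I, hI, k, rfl⟩ := exists_phi_eq NeZero.one_le hpn F hF
      have hmem : MvPolynomial.monomial (initExp I k) (∏ m : Fin p, l (k + m.rev))⁻¹ ∈
          initialPluecker n p := by
        have h1 : MvPolynomial.monomial (initExp I k) (1 : ℂ) ∈ initialPluecker n p := by
          rw [initialPluecker_eq_adjoin hpn]
          exact Algebra.subset_adjoin ⟨(⟨I, hI⟩, k), rfl⟩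
        have h2 := Subalgebra.smul_mem _ h1 (∏ m : Fin p, l (k + m.rev))⁻¹
        rwa [MvPolynomial.smul_monomial, smul_eq_mul, mul_one] at h2
      refine ⟨⟨_, hmem⟩, ?_⟩
      change termHom n p l (MvPolynomial.monomial (initExp I k) _) = _
      rw [termHom_initExp, inv_mul_cancel₀ (Finset.prod_ne_zero_iff.2 fun m _ => hl _),
        hibiTerm_eq_C_mul, map_one, one_mul]
    rintro ⟨g, hg⟩
    obtain ⟨f, hf⟩ := h hg
    exact ⟨f, Subtype.ext hf⟩

theorem initialPluecker_algHom_ext (hpn : p < n) {B : Type*} [Semiring B] [Algebra ℂ B]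
    (Ψ Φ : initialPluecker n p →ₐ[ℂ] B)
    (h : ∀ I : Fin p → Fin n, StrictMono I → ∀ k, Ψ (initialD I k) = Φ (initialD I k)) :
    Ψ = Φ := by
  have hle : initialPluecker n p ≤ (AlgHom.equalizer Ψ Φ).map (initialPluecker n p).val := by
    conv_lhs => rw [initialPluecker_eq_adjoin hpn]
    refine Algebra.adjoin_le ?_
    rintro _ ⟨x, rfl⟩
    refine ⟨(initSign p x.2)⁻¹ • initialD x.1.1 x.2, Subalgebra.smul_mem _ (h _ x.1.2 _) _, ?_⟩
    change (initSign p x.2)⁻¹ • (initialD x.1.1 x.2 : MvPolynomial (ZVar n p) ℂ) = _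
    rw [coe_initialD x.1.2, MvPolynomial.smul_monomial, smul_eq_mul,
      inv_mul_cancel₀ (initSign_ne_zero _)]
  ext f
  obtain ⟨g, hg, hgf⟩ := hle f.2
  have : g = f := Subtype.ext hgf
  exact this ▸ hg

theorem nonempty_gradedAlgebra_initialGrade (hpn : p < n) :
    Nonempty (GradedAlgebra (initialGrade n p)) := by
  let 𝓗 : ℕ → Submodule ℂ (MvPolynomial (ZVar n p) ℂ) := fun d =>
    MvPolynomial.homogeneousSubmodule (ZVar n p) ℂ (p * d)
  have : SetLike.GradedMonoid 𝓗 :=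
    { one_mem := MvPolynomial.isHomogeneous_one _ _
      mul_mem := fun i j f g hf hg => by
        have h := MvPolynomial.IsHomogeneous.mul hf hg
        rw [← mul_add] at h
        exact h }
  have := MvPolynomial.gradedAlgebra (σ := ZVar n p) (R := ℂ)
  have hind : iSupIndep 𝓗 :=
    (DirectSum.Decomposition.isInternal
      (MvPolynomial.homogeneousSubmodule (ZVar n p) ℂ)).submodule_iSupIndep.comp
      (mul_right_injective₀ (NeZero.ne p))
  refine nonempty_gradedAlgebra_comap 𝓗 hind (initialPluecker n p) _
    (initialPluecker_eq_adjoin hpn) ?_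
  rintro _ ⟨x, rfl⟩
  refine MvPolynomial.isHomogeneous_monomial _ ?_
  rw [initExp, degree_rowExp, mul_one]

theorem nonempty_gradedAlgebra_hibiGrade {P : Type*} [LE P] (O C : Set P) :
    Nonempty (GradedAlgebra (hibiGrade P O C)) := by
  refine nonempty_gradedAlgebra_comap (sGrade P) iSupIndep_sGrade (hibiRing P O C) _ rfl ?_
  rintro _ ⟨F, -, rfl⟩
  refine ⟨MvPolynomial.monomial (idealPoint O C F) 1, ?_⟩
  rw [sMonomial, Polynomial.X_mul_C, Polynomial.C_mul_X_eq_monomial]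
  rfl

end Isomorphism

end SemiInfinite

end

theorem lemma3 (n p : ℕ) (hp : 1 ≤ p) (hpn : p < n) :
    -- both algebras are graded by `ℕ`
    Nonempty (GradedAlgebra (SemiInfinite.initialGrade n p)) ∧
    Nonempty (GradedAlgebra
      (SemiInfinite.hibiGrade (SemiInfinite.TildeQ n p) Set.univ ∅)) ∧
    ∃ Φ : SemiInfinite.initialPluecker n p ≃ₐ[ℂ]
        SemiInfinite.hibiRing (SemiInfinite.TildeQ n p) Set.univ ∅,
      -- `Φ` is compatible with the gradings
      (∀ (d : ℕ) (x : SemiInfinite.initialPluecker n p),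
        x ∈ SemiInfinite.initialGrade n p d ↔
          Φ x ∈ SemiInfinite.hibiGrade (SemiInfinite.TildeQ n p) Set.univ ∅ d) ∧
      -- `Φ` is given by the formula on the initial terms of the `D_I^{(k)}`
      (∀ I : Fin p → Fin n, StrictMono I → ∀ k : ℕ,
        (Φ (SemiInfinite.initialD I k) : Polynomial (MvPolynomial (SemiInfinite.TildeQ n p) ℂ)) =
          (-1) ^ (n.choose 2 + (k % p) * (n - 1)) *
            SemiInfinite.sMonomial
              (SemiInfinite.idealPoint Set.univ ∅ (SemiInfinite.phi I k))) ∧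
      -- and is determined by it
      (∀ Ψ : SemiInfinite.initialPluecker n p ≃ₐ[ℂ]
          SemiInfinite.hibiRing (SemiInfinite.TildeQ n p) Set.univ ∅,
        (∀ I : Fin p → Fin n, StrictMono I → ∀ k : ℕ,
          Ψ (SemiInfinite.initialD I k) = Φ (SemiInfinite.initialD I k)) → Ψ = Φ) := by
  have : NeZero p := ⟨by omega⟩
  -- The prescribed window products turn the actual coefficient of each initial term into the
  -- required sign, so the sign of `initPerm` never has to be computed.
  obtain ⟨l, hl, hprod⟩ := SemiInfinite.exists_scaling hp
    (fun k => (-1) ^ (n.choose 2 + (k % p) * (n - 1)) / SemiInfinite.initSign p k)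
    (fun k => div_ne_zero (pow_ne_zero _ (neg_ne_zero.2 one_ne_zero))
      (SemiInfinite.initSign_ne_zero k))
  refine ⟨SemiInfinite.nonempty_gradedAlgebra_initialGrade hpn,
    SemiInfinite.nonempty_gradedAlgebra_hibiGrade _ _,
    AlgEquiv.ofBijective (SemiInfinite.initialToHibi hpn l)
      (SemiInfinite.initialToHibi_bijective hpn l hl), fun d x => ?_, fun I hI k => ?_,
    fun Ψ hΨ => ?_⟩
  · exact SemiInfinite.mem_sGrade_termHom_iff hpn l hl x.2 d
  · change SemiInfinite.termHom n p l (SemiInfinite.initialD I k) = _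
    rw [SemiInfinite.coe_initialD hI, SemiInfinite.termHom_initExp, hprod,
      mul_div_cancel₀ _ (SemiInfinite.initSign_ne_zero k), SemiInfinite.hibiTerm_eq_C_mul,
      map_pow, map_neg, map_one]
  · refine AlgEquiv.ext fun x => ?_
    exact DFunLike.congr_fun (SemiInfinite.initialPluecker_algHom_ext hpn Ψ.toAlgHom
      (AlgEquiv.ofBijective (SemiInfinite.initialToHibi hpn l) _).toAlgHom hΨ) x
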